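/- Let $\lambda>0$ and $0<\alpha\le 1$. Write $$E_{\alpha,\beta}^{\gamma}(x)=\frac1{\Gamma(\gamma)}\sum_{j\ge0}\frac{\Gamma(j+\gamma)x^j}{j!\,\Gamma(j\alpha+\beta)},\qquad W_{\beta,\omega}(x)=\sum_{k\ge0}\frac{x^k}{k!\,\Gamma(k\beta+\omega)}$$ for the three-parameter Mittag-Leffler function and the Wright function (with $1/\Gamma=0$ at the poles of $\Gamma$). Let $\{\hat N_\alpha(t)\}_{t\ge0}$ be the renewal process whose i.i.d. interarrival times have density $$\lambda^2x^{2\alpha-1}E^{2}_{\alpha,2\alpha}(-\lambda x^\alpha),\qquad x>0,$$ and let $\{\hat N(t)\}_{t\ge0}$ be this process for $\alpha=1$, that is, the renewal process whose interarrival times have the Gamma density $\lambda^2xe^{-\lambda x}$, $x>0$. For $t>0$ let $T_{2\alpha}(t)$ be a nonnegative random time distributed according to the folded solution of the fractional diffusion equation $\partial_t^{2\alpha}u=\partial_x^2u$ with $u(x,0)=\delta(x)$ (and $\partial_tu(x,0)=0$ if $\alpha>\tfrac12$); explicitly, for $0<\alpha<1$ it has the density $$\bar u_{2\alpha}(x,t)=\frac1{t^{\alpha}}\,W_{-\alpha,1-\alpha}\!\Big(-\frac{x}{t^{\alpha}}\Big),\quad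 x>0,\qquad \bar u_{2\alpha}(x,t)=0,\quad x<0,$$ and for $\alpha=1$ its law is the Dirac mass at $t$. Suppose that the process $\{\hat N(s)\}_{s\ge0}$ is independent of $\{T_{2\alpha}(t)\}_{t>0}$. Then $$\hat N_\alpha(t)\overset{d}{=}\hat N\big(T_{2\alpha}(t)\big)\qquad\text{for every } t>0.$$ -/

import Mathlib

open MeasureTheory ProbabilityTheory
open scoped NNReal

/-- The three-parameter Mittag-Leffler function
`E_{α,β}^γ(x) = (1/Γ(γ)) ∑_{j ≥ 0} Γ(j+γ) x^j / (j! Γ(jα+β))`, for `α, β, γ > 0`. -/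
noncomputable def mittagLeffler (α β γ x : ℝ) : ℝ :=
  (1 / Real.Gamma γ) *
    ∑' j : ℕ, Real.Gamma (j + γ) * x ^ j / ((j.factorial : ℝ) * Real.Gamma (j * α + β))

/-- The Wright function `W_{β,ω}(x) = ∑_{k ≥ 0} x^k / (k! Γ(kβ+ω))`, for `β > -1`.
Since `Real.Gamma` is `0` at the poles of the Gamma function and `y / 0 = 0`, the reciprocal
`1/Γ` has its usual value `0` there. -/
noncomputable def wright (β ω x : ℝ) : ℝ :=
  ∑' k : ℕ, x ^ k / ((k.factorial : ℝ) * Real.Gamma (k * β + ω))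

/-- The interarrival density `x ↦ r² x^{2α-1} E_{α,2α}^2(-r x^α)` on `(0, ∞)`. -/
noncomputable def interarrivalDensity (α r x : ℝ) : ℝ :=
  if 0 < x then r ^ 2 * x ^ (2 * α - 1) * mittagLeffler α (2 * α) 2 (-r * x ^ α) else 0

/-- The interarrival law, having density `interarrivalDensity α r`. -/
noncomputable def interarrivalLaw (α r : ℝ) : Measure ℝ :=
  volume.withDensity fun x => ENNReal.ofReal (interarrivalDensity α r x)

/-- `N` is a renewal process under `P` with interarrival law `μ`: there are i.i.d. interarrival
times `W 0, W 1, …` with law `μ` such that almost surely, for all times `t ≥ 0`, `N t` is the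
largest `n` with `W 0 + ⋯ + W (n-1) ≤ t`. -/
def IsRenewalProcess {Ω : Type*} [MeasurableSpace Ω] (N : ℝ≥0 → Ω → ℕ) (μ : Measure ℝ)
    (P : Measure Ω) : Prop :=
  ∃ W : ℕ → Ω → ℝ, (∀ i, HasLaw (W i) μ P) ∧ iIndepFun W P ∧
    ∀ᵐ ω ∂P, ∀ (t : ℝ≥0) (n : ℕ), n ≤ N t ω ↔ ∑ i ∈ Finset.range n, W i ω ≤ (t : ℝ)

/-- The renewal process with Mittag-Leffler waiting times, with parameters `α` and `r`. -/
def IsMLRenewalProcess {Ω : Type*} [MeasurableSpace Ω] (α r : ℝ) (N : ℝ≥0 → Ω → ℕ)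
    (P : Measure Ω) : Prop :=
  IsRenewalProcess N (interarrivalLaw α r) P

/-- For `0 < α < 1`, the solution `u_{2α}(x,t) = (1/(2 t^α)) W_{-α,1-α}(-|x|/t^α)` of the
fractional diffusion equation `∂^{2α} u / ∂t^{2α} = ∂² u / ∂x²` with `u(x,0) = δ(x)`
(and `∂u/∂t (x,0) = 0` if `α > 1/2`). -/
noncomputable def diffusionSolution (α x t : ℝ) : ℝ :=
  1 / (2 * t ^ α) * wright (-α) (1 - α) (-|x| / t ^ α)

/-- The folded solution: `2 u_{2α}(x,t)` for `x > 0`, and `0` for `x < 0`. -/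
noncomputable def foldedSolution (α x t : ℝ) : ℝ :=
  if 0 < x then 2 * diffusionSolution α x t else 0

open Classical in
/-- The law of the random time `T_{2α}(t)`. For `0 < α < 1` it has density
`x ↦ foldedSolution α x t`. For `α = 1` the equation is the wave equation, whose solution
`(δ_t + δ_{-t})/2` has no density; folded, it is the Dirac mass at `t`. -/
noncomputable def randomTimeLaw (α t : ℝ) : Measure ℝ :=
  if α = 1 then Measure.dirac t
  else volume.withDensity fun x => ENNReal.ofReal (foldedSolution α x t)

/-! ### The Gamma integral along a rotated ray -/

/-! Both sides are compared through the arrival times `S_n = W 0 + ⋯ + W (n-1)`, since `n ≤ N t`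
means `S_n ≤ t`. For every `α` the distribution function of `S_n` on `[0, ∞)` is `∑ c_j t^{αj} /
Γ(αj+1)`, where the `c_j` are the power series coefficients of `(rX/(1+rX))^{2n}` and so do not
involve `α`. Indeed the interarrival density is the derivative of such a series
(`interarrivalDensity_eq_mlDerivSeries`), and by the Beta integral a convolution of two series
becomes the Cauchy product of their coefficients (`setIntegral_mlSeries_mul_mlDerivSeries`,
`measureReal_arrival_le`).

The random time has moments `j! t^{αj} / Γ(αj+1)` (`randomTimeLaw_moment`). Averaging `∑ c_j x^j /
j!` over it therefore gives `∑ c_j t^{αj} / Γ(αj+1)` with the same `c_j`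
(`integral_mlSeries_randomTimeLaw`). By independence this average is the probability that `S_n` for
`α = 1` is at most the random time.

For `α < 1` the moments come from Hankel's formula for `1/Γ`. It turns the Wright series into a
contour integral of `e^{z - x z^α} z^{α-1}`; integrating in `x` first produces another Hankel
integral (`wright_moment`).

Positivity is not read off the series. The folded solution is nonnegative a.e. because its positive
part is the density of a probability law while its integral is also 1. The interarrival density is
nonnegative because its primitive is an average of increasing functions (`monotoneOn_mlSeries`). -/

theorem integrableOn_rpow_mul_exp_neg_mul {s κ : ℝ} (hs : -1 < s) (hκ : 0 < κ) :
    IntegrableOn (fun u : ℝ => u ^ s * Real.exp (-κ * u)) (Set.Ioi 0) := by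
  have h := integrableOn_rpow_mul_exp_neg_mul_rpow hs (zero_lt_one) hκ
  simpa using h

theorem integrableOn_rpow_mul_cexp_neg_mul {s : ℝ} (hs : -1 < s) {ζ : ℂ} (hζ : 0 < ζ.re) :
    IntegrableOn (fun u : ℝ => ((u ^ s : ℝ) : ℂ) * Complex.exp (-ζ * u)) (Set.Ioi 0) := by
  refine (integrableOn_rpow_mul_exp_neg_mul hs hζ).mono' ?_ ?_
  · exact (by fun_prop : Measurable
      fun u : ℝ => ((u ^ s : ℝ) : ℂ) * Complex.exp (-ζ * u)).aestronglyMeasurable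
  · refine (ae_restrict_iff' measurableSet_Ioi).2 (.of_forall fun u hu => ?_)
    have hu : (0 : ℝ) < u := hu
    rw [norm_mul, Complex.norm_real, Complex.norm_exp, Real.norm_of_nonneg (by positivity)]
    simp

theorem hasDerivAt_integral_rpow_mul_cexp {a : ℝ} (ha : 0 < a) {ζ : ℂ} (hζ : 0 < ζ.re) :
    HasDerivAt (fun ζ : ℂ => ∫ u in Set.Ioi (0 : ℝ),
        ((u ^ (a - 1) : ℝ) : ℂ) * Complex.exp (-ζ * u))
      (∫ u in Set.Ioi (0 : ℝ), -(((u ^ a : ℝ) : ℂ) * Complex.exp (-ζ * u))) ζ := by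
  refine (hasDerivAt_integral_of_dominated_loc_of_deriv_le
    (μ := volume.restrict (Set.Ioi (0 : ℝ)))
    (F := fun (ζ : ℂ) (u : ℝ) => ((u ^ (a - 1) : ℝ) : ℂ) * Complex.exp (-ζ * u))
    (F' := fun (ζ : ℂ) (u : ℝ) => -(((u ^ a : ℝ) : ℂ) * Complex.exp (-ζ * u)))
    (bound := fun u : ℝ => u ^ a * Real.exp (-(ζ.re / 2) * u))
    (Metric.ball_mem_nhds ζ (half_pos hζ)) ?_ ?_ ?_ ?_ ?_ ?_).2
  · refine .of_forall fun w => ?_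
    exact (by fun_prop : Measurable
      fun u : ℝ => ((u ^ (a - 1) : ℝ) : ℂ) * Complex.exp (-w * u)).aestronglyMeasurable
  · exact integrableOn_rpow_mul_cexp_neg_mul (by linarith) hζ
  · exact (by fun_prop : Measurable
      fun u : ℝ => -(((u ^ a : ℝ) : ℂ) * Complex.exp (-ζ * u))).aestronglyMeasurable
  · refine (ae_restrict_iff' measurableSet_Ioi).2 (.of_forall fun u hu w hw => ?_)
    have hu : (0 : ℝ) < u := hu
    have hw' : ζ.re / 2 ≤ w.re := by
      have h1 := (Complex.abs_re_le_norm (w - ζ)).trans (mem_ball_iff_norm.1 hw).le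
      rw [Complex.sub_re] at h1
      linarith [(abs_le.1 h1).1]
    rw [norm_neg, norm_mul, Complex.norm_real, Complex.norm_exp,
      Real.norm_of_nonneg (by positivity)]
    simp only [Complex.mul_re, Complex.neg_re, Complex.ofReal_re, Complex.neg_im,
      Complex.ofReal_im, mul_zero, sub_zero]
    gcongr
  · exact integrableOn_rpow_mul_exp_neg_mul (by linarith) (half_pos hζ)
  · refine (ae_restrict_iff' measurableSet_Ioi).2 (.of_forall fun u hu w hw => ?_)
    have hu : (0 : ℝ) < u := hu
    have h1 : HasDerivAt (fun w : ℂ => -w * (u : ℂ)) (-1 * (u : ℂ)) w :=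
      (hasDerivAt_id w).neg.mul_const _
    refine (h1.cexp.const_mul (((u ^ (a - 1) : ℝ)) : ℂ)).congr_deriv ?_
    have : u ^ a = u ^ (a - 1) * u := by
      rw [← Real.rpow_add_one hu.ne', sub_add_cancel]
    rw [this]; push_cast; ring

theorem integral_rpow_mul_cexp_by_parts {a : ℝ} (ha : 0 < a) {ζ : ℂ} (hζ : 0 < ζ.re) :
    ζ * ∫ u in Set.Ioi (0 : ℝ), ((u ^ a : ℝ) : ℂ) * Complex.exp (-ζ * u) =
      a * ∫ u in Set.Ioi (0 : ℝ), ((u ^ (a - 1) : ℝ) : ℂ) * Complex.exp (-ζ * u) := by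
  have i1 := (integrableOn_rpow_mul_cexp_neg_mul (s := a - 1) (by linarith) hζ).const_mul (a : ℂ)
  have i2 := (integrableOn_rpow_mul_cexp_neg_mul (s := a) (by linarith) hζ).const_mul ζ
  have key := integral_Ioi_of_hasDerivAt_of_tendsto (a := (0 : ℝ)) (m := (0 : ℂ))
    (f := fun u : ℝ => ((u ^ a : ℝ) : ℂ) * Complex.exp (-ζ * u))
    (f' := fun u : ℝ => a * (((u ^ (a - 1) : ℝ) : ℂ) * Complex.exp (-ζ * u)) -
      ζ * (((u ^ a : ℝ) : ℂ) * Complex.exp (-ζ * u))) ?_ ?_ (i1.sub i2) ?_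
  · rw [integral_sub i1 i2, integral_const_mul, integral_const_mul,
      Real.zero_rpow ha.ne'] at key
    simp only [Complex.ofReal_zero, zero_mul, sub_zero] at key
    exact (sub_eq_zero.1 key).symm
  · refine ContinuousAt.continuousWithinAt ?_
    have : ContinuousAt (fun u : ℝ => u ^ a) 0 := Real.continuousAt_rpow_const _ _ (.inr ha.le)
    exact (Complex.continuous_ofReal.continuousAt.comp this).mul (by fun_prop)
  · intro u hu
    have hu : (0 : ℝ) < u := hu
    have h1 : HasDerivAt (fun u : ℝ => -ζ * (u : ℂ)) (-ζ * 1) u :=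
      (Complex.ofRealCLM.hasDerivAt (x := u)).const_mul (-ζ)
    have h2 := ((Real.hasDerivAt_rpow_const (x := u) (p := a) (.inl hu.ne')).ofReal_comp).mul
      h1.cexp
    refine h2.congr_deriv ?_
    push_cast; ring
  · rw [tendsto_zero_iff_norm_tendsto_zero]
    refine (tendsto_rpow_mul_exp_neg_mul_atTop_nhds_zero a ζ.re hζ).congr' ?_
    filter_upwards [Filter.eventually_gt_atTop 0] with u hu
    rw [norm_mul, Complex.norm_real, Complex.norm_exp, Real.norm_of_nonneg (by positivity)]
    simp

/-- The Gamma integral with a complex rate: `∫_0^∞ u^{a-1} e^{-ζu} du = ζ^{-a} Γ(a)`. -/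
theorem cpow_mul_integral_rpow_mul_cexp {a : ℝ} (ha : 0 < a) {ζ : ℂ} (hζ : 0 < ζ.re) :
    ζ ^ (a : ℂ) * ∫ u in Set.Ioi (0 : ℝ), ((u ^ (a - 1) : ℝ) : ℂ) * Complex.exp (-ζ * u) =
      Real.Gamma a := by
  have hopen : IsOpen {z : ℂ | 0 < z.re} := isOpen_lt continuous_const Complex.continuous_re
  -- Integration by parts makes the derivative vanish, so the product is constant on the right
  -- half-plane and equals its value at 1.
  have hd : ∀ w ∈ {z : ℂ | 0 < z.re}, HasDerivAt (fun ζ : ℂ => ζ ^ (a : ℂ) *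
      ∫ u in Set.Ioi (0 : ℝ), ((u ^ (a - 1) : ℝ) : ℂ) * Complex.exp (-ζ * u)) 0 w := by
    intro w hw
    have hw : 0 < w.re := hw
    have hw0 : w ≠ 0 := by rintro rfl; simp at hw
    have h1 := (hasDerivAt_id w).cpow_const (c := (a : ℂ)) (.inl hw)
    refine (h1.mul (hasDerivAt_integral_rpow_mul_cexp ha hw)).congr_deriv ?_
    rw [integral_neg]
    have h2 := integral_rpow_mul_cexp_by_parts ha hw
    simp only [id, mul_one]
    have h3 : w ^ (a : ℂ) = w ^ ((a : ℂ) - 1) * w := by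
      rw [Complex.cpow_sub _ _ hw0, Complex.cpow_one, div_mul_cancel₀ _ hw0]
    rw [h3]
    linear_combination (-w ^ ((a : ℂ) - 1)) * h2
  have hc := hopen.is_const_of_deriv_eq_zero
    ((convex_halfSpace_re_gt 0).isPreconnected)
    (fun w hw => (hd w hw).differentiableAt.differentiableWithinAt)
    (fun w hw => (hd w hw).deriv) hζ (show (1 : ℂ) ∈ {z : ℂ | 0 < z.re} by simp)
  refine hc.trans ?_
  rw [Complex.one_cpow, one_mul, Real.Gamma_eq_integral ha, ← integral_complex_ofReal]
  refine setIntegral_congr_fun measurableSet_Ioi fun u hu => ?_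
  push_cast
  rw [neg_one_mul, mul_comm]

/-! ### Hankel's formula on a V-shaped contour -/

/-- The point at distance `u` from `c` on the ray from `c` in the direction `e^{iφ}`. -/
noncomputable def rayPoint (φ c u : ℝ) : ℂ := c + u * Complex.exp (φ * Complex.I)

/-- The integrand `e^{iφ} e^z z^{-b}` of Hankel's integral, at `z = c + u e^{iφ}`. -/
noncomputable def hankelIntegrand (φ b c u : ℝ) : ℂ :=
  Complex.exp (φ * Complex.I) *
    (Complex.exp (rayPoint φ c u) * rayPoint φ c u ^ ((-b : ℝ) : ℂ))

theorem rayPoint_re (φ c u : ℝ) : (rayPoint φ c u).re = c + u * Real.cos φ := by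
  simp [rayPoint, Complex.exp_ofReal_mul_I_re]

theorem rayPoint_im (φ c u : ℝ) : (rayPoint φ c u).im = u * Real.sin φ := by
  simp [rayPoint, Complex.exp_ofReal_mul_I_im]

theorem measurable_rayPoint (φ c : ℝ) : Measurable (rayPoint φ c) := by
  unfold rayPoint; fun_prop

theorem measurable_hankelIntegrand (φ b c : ℝ) : Measurable (hankelIntegrand φ b c) := by
  have := measurable_rayPoint φ c
  unfold hankelIntegrand; fun_prop

theorem norm_rayPoint_le {φ c u : ℝ} (hc : 0 ≤ c) (hu : 0 ≤ u) : ‖rayPoint φ c u‖ ≤ c + u := by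
  refine (norm_add_le _ _).trans ?_
  rw [norm_mul, Complex.norm_exp_ofReal_mul_I, mul_one, Complex.norm_real, Complex.norm_real,
    Real.norm_of_nonneg hc, Real.norm_of_nonneg hu]

theorem mul_sin_le_norm_rayPoint_right {φ c u : ℝ} : u * Real.sin φ ≤ ‖rayPoint φ c u‖ := by
  rw [← rayPoint_im φ c u]
  exact Complex.im_le_norm _

/-- `c sin φ` is the distance from the origin to the line carrying the ray. This keeps the contour
away from the branch point, uniformly in `u`. -/
theorem mul_sin_le_norm_rayPoint_left {φ c u : ℝ} : c * Real.sin φ ≤ ‖rayPoint φ c u‖ := by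
  refine le_of_sq_le_sq ?_ (norm_nonneg _)
  rw [Complex.sq_norm, Complex.normSq_apply, rayPoint_re, rayPoint_im]
  have h : Real.sin φ ^ 2 = 1 - Real.cos φ ^ 2 := Real.sin_sq φ
  have : (c + u * Real.cos φ) * (c + u * Real.cos φ) + u * Real.sin φ * (u * Real.sin φ) -
      (c * Real.sin φ) ^ 2 = (u + c * Real.cos φ) ^ 2 := by
    linear_combination (u ^ 2 - c ^ 2) * h
  linarith [sq_nonneg (u + c * Real.cos φ)]

theorem rayPoint_mem_slitPlane {φ c u : ℝ} (h0 : 0 < φ) (h1 : φ < Real.pi)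
    (hu : 0 ≤ u) (hcu : 0 < c + u) : rayPoint φ c u ∈ Complex.slitPlane := by
  have hs := Real.sin_pos_of_pos_of_lt_pi h0 h1
  rcases hu.eq_or_lt with rfl | hu
  · left; rw [rayPoint_re]; linarith
  · right; rw [rayPoint_im]; positivity

theorem norm_hankelIntegrand (φ b c u : ℝ) : ‖hankelIntegrand φ b c u‖ =
    Real.exp (c + u * Real.cos φ) * ‖rayPoint φ c u‖ ^ (-b) := by
  rw [hankelIntegrand, norm_mul, norm_mul, Complex.norm_exp_ofReal_mul_I, one_mul,
    Complex.norm_exp, Complex.norm_cpow_real, rayPoint_re]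

/-- On `[m, ∞)` a power times a stretched exponential is dominated by any exponential. -/
theorem exists_rpow_mul_exp_le (s x : ℝ) {α η m : ℝ} (hα : α < 1) (hη : 0 < η)
    (hm : 0 < m) :
    ∃ C, 0 ≤ C ∧ ∀ y, m ≤ y → y ^ s * Real.exp (x * y ^ α) ≤ C * Real.exp (η * y) := by
  set g : ℝ → ℝ := fun y => y ^ s * Real.exp (x * y ^ α) * Real.exp (-η * y) with hg
  have h1 : ∀ᶠ y in Filter.atTop, g y ≤ 1 := by
    have t1 := (tendsto_rpow_mul_exp_neg_mul_atTop_nhds_zero s (η / 2) (half_pos hη)).eventually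
      (ge_mem_nhds zero_lt_one)
    have t2 : Filter.Tendsto (fun y : ℝ => x * y ^ (-(1 - α))) Filter.atTop (nhds 0) := by
      simpa using (tendsto_rpow_neg_atTop (y := 1 - α) (by linarith)).const_mul x
    filter_upwards [t1, t2.eventually (ge_mem_nhds (half_pos hη)), Filter.eventually_gt_atTop 0]
      with y h1 h2 hy
    have h3 : x * y ^ α ≤ η / 2 * y := by
      have : y ^ α = y ^ (-(1 - α)) * y := by
        rw [← Real.rpow_add_one hy.ne']; ring_nf
      rw [this, ← mul_assoc]
      gcongr
    calc g y ≤ y ^ s * Real.exp (η / 2 * y) * Real.exp (-η * y) := by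
          simp only [hg]; gcongr
      _ = y ^ s * Real.exp (-(η / 2) * y) := by
          rw [mul_assoc, ← Real.exp_add]; ring_nf
      _ ≤ 1 := h1
  obtain ⟨Y, hY⟩ := Filter.eventually_atTop.1 h1
  have hcont : ContinuousOn g (Set.Icc m Y) := by
    have : ∀ p : ℝ, ContinuousOn (fun y : ℝ => y ^ p) (Set.Icc m Y) := fun p =>
      continuousOn_id.rpow_const fun y hy => .inl (hm.trans_le hy.1).ne'
    have h1 := this s
    have h2 := this α
    fun_prop
  obtain ⟨C, hC⟩ := (isCompact_Icc.image_of_continuousOn hcont).bddAbove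
  refine ⟨max C 1, by positivity, fun y hy => ?_⟩
  have h4 : g y ≤ max C 1 := by
    rcases le_total Y y with h | h
    · exact (hY y h).trans (le_max_right _ _)
    · exact (hC ⟨y, ⟨hy, h⟩, rfl⟩).trans (le_max_left _ _)
  calc y ^ s * Real.exp (x * y ^ α) = g y * Real.exp (η * y) := by
        simp only [hg]; rw [mul_assoc _ (Real.exp (-η * y)), ← Real.exp_add]; simp
    _ ≤ _ := by gcongr

/-- The factor `e^z` decays at rate `-cos φ` along the ray, and half of this rate absorbs the power
and the stretched exponential because `α < 1`. Uniformity in `c` is what allows differentiation in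
the starting point. -/
theorem exists_rayPoint_bound (s x : ℝ) {α φ m M : ℝ} (hα : α < 1)
    (h1 : Real.pi / 2 < φ) (h2 : φ < Real.pi) (hm : 0 < m) :
    ∃ C, 0 ≤ C ∧ ∀ c u, m ≤ c → c ≤ M → 0 ≤ u →
      Real.exp (c + u * Real.cos φ) * (‖rayPoint φ c u‖ ^ s *
        Real.exp (x * ‖rayPoint φ c u‖ ^ α)) ≤ C * Real.exp (Real.cos φ / 2 * u) := by
  have hcos : Real.cos φ < 0 := Real.cos_neg_of_pi_div_two_lt_of_lt h1 (by linarith [Real.pi_pos])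
  have hsin := Real.sin_pos_of_pos_of_lt_pi (by linarith [Real.pi_pos]) h2
  obtain ⟨C, hC0, hC⟩ := exists_rpow_mul_exp_le s x hα (η := -Real.cos φ / 2)
    (by linarith) (mul_pos hm hsin)
  refine ⟨Real.exp M * C * Real.exp (-Real.cos φ / 2 * M), by positivity,
    fun c u hmc hcM hu => ?_⟩
  have hz : m * Real.sin φ ≤ ‖rayPoint φ c u‖ :=
    (mul_le_mul_of_nonneg_right hmc hsin.le).trans mul_sin_le_norm_rayPoint_left
  have hz' : ‖rayPoint φ c u‖ ≤ M + u :=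
    (norm_rayPoint_le (hm.le.trans hmc) hu).trans (by linarith)
  have hpos : 0 ≤ -Real.cos φ / 2 := by linarith
  calc _ ≤ Real.exp (M + u * Real.cos φ) * (C * Real.exp (-Real.cos φ / 2 * (M + u))) := by
        refine mul_le_mul (by gcongr) ((hC _ hz).trans (by gcongr)) (by positivity) (by positivity)
    _ = _ := by
        have : u * Real.cos φ = Real.cos φ / 2 * u + Real.cos φ / 2 * u := by ring
        rw [this, mul_add, Real.exp_add, Real.exp_add, Real.exp_add]
        have : Real.exp (-Real.cos φ / 2 * u) * Real.exp (Real.cos φ / 2 * u) = 1 := by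
          rw [← Real.exp_add]; ring_nf; simp
        linear_combination (Real.exp M * Real.exp (Real.cos φ / 2 * u) * C *
          Real.exp (-Real.cos φ / 2 * M)) * this

theorem integrableOn_exp_neg_half_cos {φ : ℝ} (h1 : Real.pi / 2 < φ) (h2 : φ < Real.pi) (C : ℝ) :
    IntegrableOn (fun u : ℝ => C * Real.exp (Real.cos φ / 2 * u)) (Set.Ioi 0) := by
  have hcos : Real.cos φ < 0 := Real.cos_neg_of_pi_div_two_lt_of_lt h1 (by linarith [Real.pi_pos])
  have := integrableOn_rpow_mul_exp_neg_mul (s := 0) (κ := -(Real.cos φ / 2)) (by norm_num)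
    (by linarith)
  simpa [IntegrableOn] using this.const_mul C

theorem exists_norm_hankelIntegrand_le (b : ℝ) {φ m M : ℝ}
    (h1 : Real.pi / 2 < φ) (h2 : φ < Real.pi) (hm : 0 < m) :
    ∃ C, 0 ≤ C ∧ ∀ c u, m ≤ c → c ≤ M → 0 ≤ u →
      ‖hankelIntegrand φ b c u‖ ≤ C * Real.exp (Real.cos φ / 2 * u) := by
  -- With coefficient 0 the stretched exponential is 1, so any exponent below 1 serves.
  obtain ⟨C, hC0, hC⟩ := exists_rayPoint_bound (-b) 0 (α := 1 / 2) (M := M)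
    (by norm_num) h1 h2 hm
  refine ⟨C, hC0, fun c u hc hc' hu => ?_⟩
  rw [norm_hankelIntegrand]
  simpa using hC c u hc hc' hu

theorem integrableOn_hankelIntegrand (b : ℝ) {φ c : ℝ}
    (h1 : Real.pi / 2 < φ) (h2 : φ < Real.pi) (hc : 0 < c) :
    IntegrableOn (hankelIntegrand φ b c) (Set.Ioi 0) := by
  obtain ⟨C, -, hC⟩ := exists_norm_hankelIntegrand_le b (M := c) h1 h2 hc
  refine (integrableOn_exp_neg_half_cos h1 h2 C).mono'
    (measurable_hankelIntegrand φ b c).aestronglyMeasurable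
    ((ae_restrict_iff' measurableSet_Ioi).2 (.of_forall fun u hu => ?_))
  exact hC c u le_rfl le_rfl (le_of_lt hu)

theorem hasDerivAt_exp_mul_cpow (b : ℝ) {z : ℂ} (hz : z ∈ Complex.slitPlane) :
    HasDerivAt (fun z : ℂ => Complex.exp z * z ^ ((-b : ℝ) : ℂ))
      (Complex.exp z * z ^ ((-b : ℝ) : ℂ) -
        b * (Complex.exp z * z ^ ((-(b + 1) : ℝ) : ℂ))) z := by
  refine ((Complex.hasDerivAt_exp z).mul
    ((hasDerivAt_id z).cpow_const (c := ((-b : ℝ) : ℂ)) hz)).congr_deriv ?_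
  have : ((-(b + 1) : ℝ) : ℂ) = ((-b : ℝ) : ℂ) - 1 := by push_cast; ring
  rw [this]
  simp only [id]
  push_cast
  ring

/-- The combined integrand is the derivative of `e^z z^{-b}` along the ray, so only the endpoint `c`
contributes. That contribution is real; imaginary parts thus satisfy the functional equation of
`1/Γ`. -/
theorem integral_hankelIntegrand_sub (b : ℝ) {φ c : ℝ}
    (h1 : Real.pi / 2 < φ) (h2 : φ < Real.pi) (hc : 0 < c) :
    (∫ u in Set.Ioi 0, hankelIntegrand φ b c u) - b * ∫ u in Set.Ioi 0,
      hankelIntegrand φ (b + 1) c u = -((Real.exp c * c ^ (-b) : ℝ) : ℂ) := by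
  have hcos : Real.cos φ < 0 := Real.cos_neg_of_pi_div_two_lt_of_lt h1 (by linarith [Real.pi_pos])
  have h0 : 0 < φ := by linarith [Real.pi_pos]
  have i1 := integrableOn_hankelIntegrand b h1 h2 hc
  have i2 := (integrableOn_hankelIntegrand (b + 1) h1 h2 hc).const_mul (b : ℂ)
  have hd : ∀ u : ℝ, 0 ≤ u → HasDerivAt
      (fun u : ℝ => Complex.exp (rayPoint φ c u) * rayPoint φ c u ^ ((-b : ℝ) : ℂ))
      (hankelIntegrand φ b c u - b * hankelIntegrand φ (b + 1) c u) u := by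
    intro u hu
    have hr : HasDerivAt (rayPoint φ c) (1 * Complex.exp (φ * Complex.I)) u :=
      ((Complex.ofRealCLM.hasDerivAt (x := u)).mul_const _).const_add _
    have := (hasDerivAt_exp_mul_cpow b
      (rayPoint_mem_slitPlane h0 h2 hu (by linarith))).comp u hr
    refine this.congr_deriv ?_
    unfold hankelIntegrand
    ring
  have key := integral_Ioi_of_hasDerivAt_of_tendsto (m := (0 : ℂ))
    (hd 0 le_rfl).continuousAt.continuousWithinAt (fun u hu => hd u (le_of_lt hu)) (i1.sub i2) ?_
  · rw [integral_sub i1 i2, integral_const_mul] at key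
    rw [key, zero_sub]
    simp only [rayPoint, Complex.ofReal_zero, zero_mul, add_zero]
    rw [Complex.ofReal_mul, Complex.ofReal_cpow hc.le, Complex.ofReal_exp]
  · obtain ⟨C, -, hC⟩ := exists_norm_hankelIntegrand_le b (M := c) h1 h2 hc
    refine squeeze_zero_norm' (a := fun u => C * Real.exp (Real.cos φ / 2 * u)) ?_ ?_
    · filter_upwards [Filter.eventually_ge_atTop 0] with u hu
      refine le_trans (le_of_eq ?_) (hC c u le_rfl le_rfl hu)
      rw [hankelIntegrand, norm_mul (Complex.exp (φ * Complex.I)), Complex.norm_exp_ofReal_mul_I,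
        one_mul]
    · rw [← mul_zero C]
      refine (Real.tendsto_exp_atBot.comp ?_).const_mul C
      exact Filter.tendsto_id.const_mul_atTop_of_neg (by linarith)

/-- Translating the ray differentiates `e^z z^{-b}`, which again leaves an endpoint term. As it is
real, the imaginary part does not depend on `c`; this plays the role of Cauchy's theorem. -/
theorem hasDerivAt_integral_hankelIntegrand (b : ℝ) {φ c : ℝ}
    (h1 : Real.pi / 2 < φ) (h2 : φ < Real.pi) (hc : 0 < c) :
    HasDerivAt (fun c : ℝ => ∫ u in Set.Ioi 0, hankelIntegrand φ b c u)
      (-((Real.exp c * c ^ (-b) : ℝ) : ℂ)) c := by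
  have h0 : 0 < φ := by linarith [Real.pi_pos]
  obtain ⟨C, -, hC⟩ := exists_norm_hankelIntegrand_le b (m := c / 2) (M := 2 * c) h1 h2 (by linarith)
  obtain ⟨C', -, hC'⟩ :=
    exists_norm_hankelIntegrand_le (b + 1) (m := c / 2) (M := 2 * c) h1 h2 (by linarith)
  have hball : ∀ x ∈ Metric.ball c (c / 2), c / 2 ≤ x ∧ x ≤ 2 * c := fun x hx => by
    rw [Real.ball_eq_Ioo] at hx
    constructor <;> linarith [hx.1, hx.2]
  have := (hasDerivAt_integral_of_dominated_loc_of_deriv_le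
    (μ := volume.restrict (Set.Ioi (0 : ℝ)))
    (F := fun c u => hankelIntegrand φ b c u)
    (F' := fun c u => hankelIntegrand φ b c u - b * hankelIntegrand φ (b + 1) c u)
    (bound := fun u : ℝ => C * Real.exp (Real.cos φ / 2 * u) +
      |b| * (C' * Real.exp (Real.cos φ / 2 * u)))
    (Metric.ball_mem_nhds c (half_pos hc)) ?_ ?_ ?_ ?_ ?_ ?_).2
  · rw [integral_sub, integral_const_mul, integral_hankelIntegrand_sub b h1 h2 hc] at this
    · exact this
    · exact integrableOn_hankelIntegrand b h1 h2 hc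
    · exact (integrableOn_hankelIntegrand (b + 1) h1 h2 hc).const_mul _
  · exact .of_forall fun c => (measurable_hankelIntegrand φ b c).aestronglyMeasurable
  · exact integrableOn_hankelIntegrand b h1 h2 hc
  · have := measurable_hankelIntegrand φ b c
    have := measurable_hankelIntegrand φ (b + 1) c
    exact (by fun_prop : Measurable fun u =>
      hankelIntegrand φ b c u - b * hankelIntegrand φ (b + 1) c u).aestronglyMeasurable
  · refine (ae_restrict_iff' measurableSet_Ioi).2 (.of_forall fun u hu x hx => ?_)
    obtain ⟨hx1, hx2⟩ := hball x hx
    refine (norm_sub_le _ _).trans ?_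
    rw [norm_mul, Complex.norm_real, Real.norm_eq_abs]
    exact add_le_add (hC x u hx1 hx2 (le_of_lt hu))
      (mul_le_mul_of_nonneg_left (hC' x u hx1 hx2 (le_of_lt hu)) (abs_nonneg b))
  · exact (integrableOn_exp_neg_half_cos h1 h2 C).add
      ((integrableOn_exp_neg_half_cos h1 h2 C').const_mul _)
  · refine (ae_restrict_iff' measurableSet_Ioi).2 (.of_forall fun u hu x hx => ?_)
    have hu : (0 : ℝ) < u := hu
    obtain ⟨hx1, hx2⟩ := hball x hx
    have hr : HasDerivAt (fun x : ℝ => rayPoint φ x u) 1 x :=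
      (Complex.ofRealCLM.hasDerivAt (x := x)).add_const _
    have h3 := (hasDerivAt_exp_mul_cpow b
      (rayPoint_mem_slitPlane (c := x) h0 h2 hu.le (by linarith))).comp x hr
    refine (h3.const_mul (Complex.exp (φ * Complex.I))).congr_deriv ?_
    unfold hankelIntegrand
    ring

theorem im_integral_hankelIntegrand_eq (b : ℝ) {φ c c' : ℝ}
    (h1 : Real.pi / 2 < φ) (h2 : φ < Real.pi) (hc : 0 < c) (hc' : 0 < c') :
    (∫ u in Set.Ioi 0, hankelIntegrand φ b c u).im =
      (∫ u in Set.Ioi 0, hankelIntegrand φ b c' u).im := by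
  have hd : ∀ x ∈ Set.Ioi (0 : ℝ), HasDerivAt
      (fun c : ℝ => (∫ u in Set.Ioi 0, hankelIntegrand φ b c u).im) 0 x := fun x hx => by
    have := Complex.imCLM.hasFDerivAt.comp_hasDerivAt x
      (hasDerivAt_integral_hankelIntegrand b h1 h2 hx)
    refine this.congr_deriv ?_
    rw [← Complex.ofReal_neg]
    exact Complex.ofReal_im (-(Real.exp x * x ^ (-b)))
  exact isOpen_Ioi.is_const_of_deriv_eq_zero isPreconnected_Ioi
    (fun x hx => (hd x hx).differentiableAt.differentiableWithinAt)
    (fun x hx => (hd x hx).deriv) hc hc'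

/-- On the ray from the origin `z = -ζu` with `ζ = e^{i(φ-π)}` in the right half-plane, so this is
the Gamma integral with complex rate `ζ`. The phase is what remains of `e^{iφ(1-b)}` after `ζ^{1-b}`
is removed. -/
theorem integral_hankelIntegrand_zero {φ b : ℝ} (h1 : Real.pi / 2 < φ) (h2 : φ < Real.pi)
    (hb1 : b < 1) :
    ∫ u in Set.Ioi 0, hankelIntegrand φ b 0 u =
      Complex.exp ((Real.pi * (1 - b) : ℝ) * Complex.I) * Real.Gamma (1 - b) := by
  set ζ : ℂ := Complex.exp ((φ - Real.pi : ℝ) * Complex.I) with hζ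
  have hζre : 0 < ζ.re := by
    rw [hζ, Complex.exp_ofReal_mul_I_re]
    exact Real.cos_pos_of_mem_Ioo ⟨by linarith, by linarith [Real.pi_pos]⟩
  have hneg : -ζ = Complex.exp (φ * Complex.I) := by
    rw [hζ, Complex.ofReal_sub, sub_mul, Complex.exp_sub, Complex.exp_pi_mul_I,
      div_neg, div_one, neg_neg]
  have key := cpow_mul_integral_rpow_mul_cexp (a := 1 - b) (by linarith) hζre
  have hlogζ : Complex.log ζ = (φ - Real.pi : ℝ) * Complex.I := by
    rw [hζ, Complex.log_exp] <;> rw [Complex.im_ofReal_mul, Complex.I_im] <;>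
      linarith [Real.pi_pos]
  have hζ0 : ζ ≠ 0 := Complex.exp_ne_zero _
  have hlog : Complex.log (Complex.exp (φ * Complex.I)) = φ * Complex.I := by
    rw [Complex.log_exp] <;> rw [Complex.im_ofReal_mul, Complex.I_im] <;>
      linarith [Real.pi_pos]
  rw [← key, Complex.cpow_def_of_ne_zero hζ0, hlogζ, ← mul_assoc, ← Complex.exp_add,
    ← integral_const_mul]
  refine setIntegral_congr_fun measurableSet_Ioi fun u hu => ?_
  have hu : (0 : ℝ) < u := hu
  have he0 := Complex.exp_ne_zero (φ * Complex.I)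
  simp only [hankelIntegrand, rayPoint, Complex.ofReal_zero, zero_add]
  rw [hneg, Complex.cpow_def_of_ne_zero (mul_ne_zero (by exact_mod_cast hu.ne') he0),
    Complex.log_ofReal_mul hu he0, hlog, show 1 - b - 1 = -b by ring, Real.rpow_def_of_pos hu,
    Complex.ofReal_exp, ← Complex.exp_add, ← Complex.exp_add, ← Complex.exp_add,
    ← Complex.exp_add]
  congr 1
  push_cast
  ring

/-- Let the starting point tend to 0: the integrands are dominated by a multiple of `u^{-b} e^{u cos
φ}`, integrable since `b < 1`. The imaginary part of the limit is `sin(πb) Γ(1-b)`, and the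
reflection formula finishes. -/
theorem im_integral_hankelIntegrand_of_mem_Ioo {φ b : ℝ} (h1 : Real.pi / 2 < φ)
    (h2 : φ < Real.pi) (hb0 : 0 < b) (hb1 : b < 1) :
    (∫ u in Set.Ioi 0, hankelIntegrand φ b 1 u).im = Real.pi / Real.Gamma b := by
  have hcos : Real.cos φ < 0 := Real.cos_neg_of_pi_div_two_lt_of_lt h1 (by linarith [Real.pi_pos])
  have h0 : 0 < φ := by linarith [Real.pi_pos]
  have hsin := Real.sin_pos_of_pos_of_lt_pi h0 h2
  have hmem : ∀ᶠ c : ℝ in nhdsWithin 0 (Set.Ioi 0), 0 < c ∧ c ≤ 1 := by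
    filter_upwards [Ioc_mem_nhdsGT (zero_lt_one (α := ℝ))] with c hc using hc
  have hlim : Filter.Tendsto (fun c : ℝ => ∫ u in Set.Ioi 0, hankelIntegrand φ b c u)
      (nhdsWithin 0 (Set.Ioi 0)) (nhds (∫ u in Set.Ioi 0, hankelIntegrand φ b 0 u)) := by
    refine tendsto_integral_filter_of_dominated_convergence
      (fun u => Real.exp 1 * Real.sin φ ^ (-b) * (u ^ (-b) * Real.exp (-(-Real.cos φ) * u)))
      (.of_forall fun c => (measurable_hankelIntegrand φ b c).aestronglyMeasurable) ?_ ?_ ?_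
    · filter_upwards [hmem] with c hc
      refine (ae_restrict_iff' measurableSet_Ioi).2 (.of_forall fun u hu => ?_)
      have hu : (0 : ℝ) < u := hu
      rw [norm_hankelIntegrand]
      calc _ ≤ Real.exp (1 + u * Real.cos φ) * (u * Real.sin φ) ^ (-b) := by
            refine mul_le_mul (Real.exp_le_exp.2 (by linarith [hc.2])) ?_ (by positivity)
              (by positivity)
            · exact Real.rpow_le_rpow_of_nonpos (by positivity) mul_sin_le_norm_rayPoint_right
                (by linarith)
        _ = _ := by
            rw [Real.mul_rpow hu.le hsin.le, Real.exp_add, neg_neg, mul_comm u]; ring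
    · exact (integrableOn_rpow_mul_exp_neg_mul (by linarith) (by linarith)).const_mul _
    · refine (ae_restrict_iff' measurableSet_Ioi).2 (.of_forall fun u hu => ?_)
      have hu : (0 : ℝ) < u := hu
      have hr : Filter.Tendsto (fun c : ℝ => rayPoint φ c u) (nhdsWithin 0 (Set.Ioi 0))
          (nhds (rayPoint φ 0 u)) := by
        refine (Continuous.tendsto ?_ 0).mono_left nhdsWithin_le_nhds
        unfold rayPoint; fun_prop
      have hs := rayPoint_mem_slitPlane (c := 0) h0 h2 hu.le (by linarith)
      exact ((hasDerivAt_exp_mul_cpow b hs).continuousAt.tendsto.comp hr).const_mul _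
  have hlim2 := (Complex.continuous_im.tendsto _).comp hlim
  have hlim3 : Filter.Tendsto (Complex.im ∘ fun c : ℝ => ∫ u in Set.Ioi 0, hankelIntegrand φ b c u)
      (nhdsWithin 0 (Set.Ioi 0)) (nhds (∫ u in Set.Ioi 0, hankelIntegrand φ b 1 u).im) := by
    refine tendsto_const_nhds.congr' ?_
    filter_upwards [hmem] with c hc
    exact im_integral_hankelIntegrand_eq b h1 h2 one_pos hc.1
  rw [tendsto_nhds_unique hlim3 hlim2, integral_hankelIntegrand_zero h1 h2 hb1,
    Complex.im_mul_ofReal, Complex.exp_ofReal_mul_I_im]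
  have hr := Real.Gamma_mul_Gamma_one_sub b
  have hsb : 0 < Real.sin (Real.pi * b) := Real.sin_pos_of_pos_of_lt_pi (by positivity)
    (by nlinarith [Real.pi_pos])
  have : Real.sin (Real.pi * (1 - b)) = Real.sin (Real.pi * b) := by
    rw [mul_sub, mul_one, Real.sin_pi_sub]
  rw [this, eq_div_iff (Real.Gamma_pos_of_pos hb0).ne']
  rw [eq_div_iff hsb.ne'] at hr
  linarith

theorem im_integral_hankelIntegrand_recursion (b : ℝ) {φ : ℝ} (h1 : Real.pi / 2 < φ)
    (h2 : φ < Real.pi) : (∫ u in Set.Ioi 0, hankelIntegrand φ b 1 u).im =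
      b * (∫ u in Set.Ioi 0, hankelIntegrand φ (b + 1) 1 u).im := by
  have := congrArg Complex.im (integral_hankelIntegrand_sub b h1 h2 one_pos)
  rw [Complex.sub_im, Complex.im_ofReal_mul, Complex.neg_im, Complex.ofReal_im] at this
  linarith

/-- At `b = 1` the ray cannot be moved to the origin, and the recursion from `b = 0` only says `0 =
0`. The value is obtained by continuity in `b` from below. -/
theorem im_integral_hankelIntegrand_one {φ : ℝ} (h1 : Real.pi / 2 < φ) (h2 : φ < Real.pi) :
    (∫ u in Set.Ioi 0, hankelIntegrand φ 1 1 u).im = Real.pi / Real.Gamma 1 := by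
  have h0 : 0 < φ := by linarith [Real.pi_pos]
  have hsin := Real.sin_pos_of_pos_of_lt_pi h0 h2
  have hmem : ∀ᶠ b : ℝ in nhdsWithin 1 (Set.Iio 1), 0 < b ∧ b < 1 := by
    filter_upwards [Ioo_mem_nhdsLT (zero_lt_one (α := ℝ))] with b hb using hb
  obtain ⟨C, -, hC⟩ := exists_norm_hankelIntegrand_le 0 (M := 1) h1 h2 one_pos
  obtain ⟨C', -, hC'⟩ := exists_norm_hankelIntegrand_le 1 (M := 1) h1 h2 one_pos
  have hlim : Filter.Tendsto (fun b : ℝ => ∫ u in Set.Ioi 0, hankelIntegrand φ b 1 u)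
      (nhdsWithin 1 (Set.Iio 1)) (nhds (∫ u in Set.Ioi 0, hankelIntegrand φ 1 1 u)) := by
    refine tendsto_integral_filter_of_dominated_convergence
      (fun u => C * Real.exp (Real.cos φ / 2 * u) + C' * Real.exp (Real.cos φ / 2 * u))
      (.of_forall fun b => (measurable_hankelIntegrand φ b 1).aestronglyMeasurable) ?_ ?_ ?_
    · filter_upwards [hmem] with b hb
      refine (ae_restrict_iff' measurableSet_Ioi).2 (.of_forall fun u hu => ?_)
      have hu : (0 : ℝ) < u := hu
      refine le_trans ?_ (add_le_add (hC 1 u le_rfl le_rfl hu.le) (hC' 1 u le_rfl le_rfl hu.le))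
      have hz : 0 < ‖rayPoint φ 1 u‖ := (mul_pos hu hsin).trans_le mul_sin_le_norm_rayPoint_right
      simp only [norm_hankelIntegrand]
      rw [← mul_add]
      gcongr
      have hp0 : 0 ≤ ‖rayPoint φ 1 u‖ ^ (-(0 : ℝ)) := by positivity
      have hp1 : 0 ≤ ‖rayPoint φ 1 u‖ ^ (-(1 : ℝ)) := by positivity
      rcases le_total 1 ‖rayPoint φ 1 u‖ with h | h
      · have := Real.rpow_le_rpow_of_exponent_le h (show -b ≤ -0 by linarith)
        linarith
      · have := Real.rpow_le_rpow_of_exponent_ge hz h (show -1 ≤ -b by linarith)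
        linarith
    · exact (integrableOn_exp_neg_half_cos h1 h2 C).add (integrableOn_exp_neg_half_cos h1 h2 C')
    · refine (ae_restrict_iff' measurableSet_Ioi).2 (.of_forall fun u hu => ?_)
      have hu : (0 : ℝ) < u := hu
      have hz : rayPoint φ 1 u ≠ 0 := Complex.slitPlane_ne_zero
        (rayPoint_mem_slitPlane h0 h2 hu.le (by linarith))
      have : Continuous fun b : ℝ => hankelIntegrand φ b 1 u := by
        unfold hankelIntegrand
        have : Continuous fun b : ℝ => rayPoint φ 1 u ^ ((-b : ℝ) : ℂ) := by
          simp only [Complex.cpow_def_of_ne_zero hz]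
          fun_prop
        fun_prop
      exact (this.tendsto 1).mono_left nhdsWithin_le_nhds
  have hlim2 := (Complex.continuous_im.tendsto _).comp hlim
  have hG : ContinuousAt Real.Gamma 1 := by
    refine (Real.differentiableAt_Gamma fun m h => ?_).continuousAt
    linarith [(Nat.cast_nonneg m : (0 : ℝ) ≤ m)]
  have hlim3 : Filter.Tendsto (fun b => Real.pi / Real.Gamma b) (nhdsWithin 1 (Set.Iio 1))
      (nhds (Real.pi / Real.Gamma 1)) :=
    ((tendsto_const_nhds.div hG.tendsto (by simp)).mono_left nhdsWithin_le_nhds)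
  refine tendsto_nhds_unique hlim2 (hlim3.congr' ?_)
  filter_upwards [hmem] with b hb
  exact (im_integral_hankelIntegrand_of_mem_Ioo h1 h2 hb.1 hb.2).symm

/-- Hankel's formula: `1/Γ(b) = (1/π) Im ∫ e^z z^{-b} dz` along the ray from `1` in the direction
`e^{iφ}`, `π/2 < φ < π`, for every real `b`. -/
theorem im_integral_hankelIntegrand (b : ℝ) {φ : ℝ} (h1 : Real.pi / 2 < φ) (h2 : φ < Real.pi) :
    (∫ u in Set.Ioi 0, hankelIntegrand φ b 1 u).im = Real.pi / Real.Gamma b := by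
  have base : ∀ b : ℝ, 0 < b → b ≤ 1 →
      (∫ u in Set.Ioi 0, hankelIntegrand φ b 1 u).im = Real.pi / Real.Gamma b := by
    intro b hb hb'
    rcases hb'.eq_or_lt with rfl | hb'
    · exact im_integral_hankelIntegrand_one h1 h2
    · exact im_integral_hankelIntegrand_of_mem_Ioo h1 h2 hb hb'
  have hdown : ∀ b : ℝ, (∫ u in Set.Ioi 0, hankelIntegrand φ (b + 1) 1 u).im =
      Real.pi / Real.Gamma (b + 1) →
      (∫ u in Set.Ioi 0, hankelIntegrand φ b 1 u).im = Real.pi / Real.Gamma b := by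
    intro b hb
    rw [im_integral_hankelIntegrand_recursion b h1 h2, hb]
    -- At `b = 0` the factor `b` kills the left side, and the right side is `π / 0 = 0` because
    -- `Real.Gamma 0 = 0`. Descending through this case also covers the other poles.
    by_cases hb0 : b = 0
    · simp [hb0, Real.Gamma_zero]
    · rw [Real.Gamma_add_one hb0]; field_simp
  have hup : ∀ b : ℝ, b ≠ 0 → (∫ u in Set.Ioi 0, hankelIntegrand φ b 1 u).im =
      Real.pi / Real.Gamma b → (∫ u in Set.Ioi 0, hankelIntegrand φ (b + 1) 1 u).im =
      Real.pi / Real.Gamma (b + 1) := by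
    intro b hb0 hb
    rw [im_integral_hankelIntegrand_recursion b h1 h2] at hb
    rw [Real.Gamma_add_one hb0, eq_div_of_mul_eq hb0 ((mul_comm _ _).trans hb)]
    field_simp
  have pos : ∀ (n : ℕ) (b : ℝ), 0 < b → b ≤ n + 1 →
      (∫ u in Set.Ioi 0, hankelIntegrand φ b 1 u).im = Real.pi / Real.Gamma b := by
    intro n
    induction n with
    | zero => intro b hb hb'; exact base b hb (by simpa using hb')
    | succ n ih =>
      intro b hb hb'
      rcases le_or_gt b 1 with h | h
      · exact base b hb h
      · have := hup (b - 1) (by linarith) (ih (b - 1) (by linarith) (by push_cast at hb'; linarith))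
        rwa [sub_add_cancel] at this
  have neg : ∀ (n : ℕ) (b : ℝ), 0 < b + n →
      (∫ u in Set.Ioi 0, hankelIntegrand φ b 1 u).im = Real.pi / Real.Gamma b := by
    intro n
    induction n with
    | zero =>
      intro b hb
      have hb : 0 < b := by simpa using hb
      exact pos ⌈b⌉₊ b hb (by linarith [Nat.le_ceil b])
    | succ n ih =>
      intro b hb
      exact hdown b (ih (b + 1) (by push_cast at hb; linarith))
  obtain ⟨n, hn⟩ := exists_nat_gt (-b)
  exact neg n b (by linarith)

/-! ### The Wright function: integral representation and moments -/

/-- `φ > π/2` makes `e^z` decay along the ray, while `αφ < π/2` keeps `z^α` in the right half-plane,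
so that `e^{-x z^α}` decays in `x`. Both are possible because `α < 1`. -/
theorem exists_angle {α : ℝ} (h0 : 0 < α) (h1 : α < 1) :
    ∃ φ, Real.pi / 2 < φ ∧ φ < Real.pi ∧ α * φ < Real.pi / 2 := by
  have hpi := Real.pi_pos
  have h : Real.pi / 2 < min Real.pi (Real.pi / 2 / α) := by
    refine lt_min (by linarith) ?_
    rw [lt_div_iff₀ h0]
    nlinarith
  obtain ⟨φ, h2, h3⟩ := exists_between h
  refine ⟨φ, h2, h3.trans_le (min_le_left _ _), ?_⟩
  have := h3.trans_le (min_le_right _ _)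
  rw [lt_div_iff₀ h0] at this
  linarith

theorem arg_rayPoint_mem {φ c u : ℝ} (h0 : 0 < φ) (h1 : φ < Real.pi) (hc : 0 < c) (hu : 0 ≤ u) :
    0 ≤ (rayPoint φ c u).arg ∧ (rayPoint φ c u).arg ≤ φ := by
  have hs := Real.sin_pos_of_pos_of_lt_pi h0 h1
  have h2 : 0 ≤ (rayPoint φ c u).arg :=
    Complex.arg_nonneg_iff.2 (by rw [rayPoint_im]; positivity)
  refine ⟨h2, ?_⟩
  by_contra! h3
  have h4 : Real.sin (φ - (rayPoint φ c u).arg) < 0 :=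
    Real.sin_neg_of_neg_of_neg_pi_lt (by linarith)
      (by linarith [Complex.arg_le_pi (rayPoint φ c u)])
  have hz : 0 < ‖rayPoint φ c u‖ := (mul_pos hc hs).trans_le mul_sin_le_norm_rayPoint_left
  -- Both sides are the distance from the origin to the line of the ray; its positivity excludes
  -- `arg z > φ`.
  have h5 : ‖rayPoint φ c u‖ * Real.sin (φ - (rayPoint φ c u).arg) = c * Real.sin φ := by
    have h6 := Complex.norm_mul_cos_arg (rayPoint φ c u)
    have h7 := Complex.norm_mul_sin_arg (rayPoint φ c u)
    rw [rayPoint_re] at h6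
    rw [rayPoint_im] at h7
    rw [Real.sin_sub]
    linear_combination Real.sin φ * h6 - Real.cos φ * h7
  nlinarith [mul_pos hc hs]

theorem exists_le_re_rayPoint_cpow {α φ c : ℝ} (hα : 0 < α) (h0 : 0 < φ) (h1 : φ < Real.pi)
    (h2 : α * φ < Real.pi / 2) (hc : 0 < c) :
    ∃ δ, 0 < δ ∧ ∀ u, 0 ≤ u → δ ≤ (rayPoint φ c u ^ (α : ℂ)).re := by
  have hs := Real.sin_pos_of_pos_of_lt_pi h0 h1
  have hcos : 0 < Real.cos (α * φ) :=
    Real.cos_pos_of_mem_Ioo ⟨by linarith [Real.pi_pos, mul_pos hα h0], h2⟩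
  refine ⟨(c * Real.sin φ) ^ α * Real.cos (α * φ), by positivity, fun u hu => ?_⟩
  obtain ⟨h3, h4⟩ := arg_rayPoint_mem h0 h1 hc hu
  rw [Complex.cpow_ofReal_re]
  have h5 : Real.cos (α * φ) ≤ Real.cos ((rayPoint φ c u).arg * α) :=
    Real.cos_le_cos_of_nonneg_of_le_pi (by positivity) (by linarith [Real.pi_pos])
      (by rw [mul_comm]; gcongr)
  have h6 : c * Real.sin φ ≤ ‖rayPoint φ c u‖ := mul_sin_le_norm_rayPoint_left
  gcongr

theorem hankelIntegrand_sub_mul {φ c u : ℝ} (h0 : 0 < φ) (h1 : φ < Real.pi) (hcu : 0 < c + u)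
    (hu : 0 ≤ u) (b α : ℝ) (k : ℕ) :
    hankelIntegrand φ (b - α * k) c u =
      hankelIntegrand φ b c u * (rayPoint φ c u ^ (α : ℂ)) ^ k := by
  have hz := Complex.slitPlane_ne_zero (rayPoint_mem_slitPlane h0 h1 hu hcu)
  rw [hankelIntegrand, hankelIntegrand, ← Complex.cpow_mul_nat,
    show ((-(b - α * k) : ℝ) : ℂ) = ((-b : ℝ) : ℂ) + α * k by push_cast; ring,
    Complex.cpow_add _ _ hz]
  ring

theorem hankelIntegrand_add_mul {φ c u : ℝ} (h0 : 0 < φ) (h1 : φ < Real.pi) (hcu : 0 < c + u)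
    (hu : 0 ≤ u) (b α : ℝ) (k : ℕ) :
    hankelIntegrand φ (b + α * k) c u * (rayPoint φ c u ^ (α : ℂ)) ^ k =
      hankelIntegrand φ b c u := by
  rw [← hankelIntegrand_sub_mul h0 h1 hcu hu, add_sub_cancel_right]

/-- Expand `e^{x z^α}` and integrate term by term: the `k`-th term has exponent `αk - ω`, and
Hankel's formula turns it into `1/Γ(ω - αk)`. The absolute series sums to `e^{|x| |z|^α}`, which the
decay of `e^z` dominates since `α < 1`. -/
theorem hasSum_wright {α φ : ℝ} (hα1 : α < 1) (h1 : Real.pi / 2 < φ)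
    (h2 : φ < Real.pi) (ω x : ℝ) :
    HasSum (fun k : ℕ => x ^ k / ((k.factorial : ℝ) * Real.Gamma (k * (-α) + ω)))
      ((∫ u in Set.Ioi 0, hankelIntegrand φ ω 1 u *
        Complex.exp (x * rayPoint φ 1 u ^ (α : ℂ))).im / Real.pi) := by
  have h0 : 0 < φ := by linarith [Real.pi_pos]
  obtain ⟨C, -, hC⟩ := exists_rayPoint_bound (-ω) |x| (M := 1) hα1 h1 h2 one_pos
  have hsum : ∀ u : ℝ, HasSum
      (fun k : ℕ => ‖hankelIntegrand φ ω 1 u‖ * ((|x| * ‖rayPoint φ 1 u‖ ^ α) ^ k / k.factorial))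
      (‖hankelIntegrand φ ω 1 u‖ * Real.exp (|x| * ‖rayPoint φ 1 u‖ ^ α)) := fun u => by
    rw [Real.exp_eq_exp_ℝ]
    exact (NormedSpace.expSeries_div_hasSum_exp (|x| * ‖rayPoint φ 1 u‖ ^ α)).mul_left _
  have key := hasSum_integral_of_dominated_convergence
    (μ := volume.restrict (Set.Ioi (0 : ℝ)))
    (F := fun (k : ℕ) u => ((x ^ k / k.factorial : ℝ) : ℂ) * hankelIntegrand φ (ω - α * k) 1 u)
    (f := fun u => hankelIntegrand φ ω 1 u * Complex.exp (x * rayPoint φ 1 u ^ (α : ℂ)))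
    (bound := fun k u =>
      ‖hankelIntegrand φ ω 1 u‖ * ((|x| * ‖rayPoint φ 1 u‖ ^ α) ^ k / k.factorial))
    ?_ ?_ ?_ ?_ ?_
  · have h3 := (Complex.hasSum_im key).div_const Real.pi
    refine h3.congr_fun fun k => ?_
    rw [integral_const_mul, Complex.im_ofReal_mul, im_integral_hankelIntegrand _ h1 h2,
      show (k : ℝ) * -α + ω = ω - α * k by ring]
    field_simp
  · intro k
    exact ((measurable_hankelIntegrand φ _ 1).const_mul _).aestronglyMeasurable
  · refine fun k => (ae_restrict_iff' measurableSet_Ioi).2 (.of_forall fun u hu => ?_)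
    have hu : (0 : ℝ) < u := hu
    rw [hankelIntegrand_sub_mul h0 h2 (by linarith) hu.le, norm_mul, norm_mul, norm_pow,
      Complex.norm_cpow_real, Complex.norm_real, norm_div, norm_pow, Real.norm_eq_abs,
      Real.norm_natCast, mul_pow]
    apply le_of_eq
    ring
  · exact .of_forall fun u => (hsum u).summable
  · simp only [fun u => (hsum u).tsum_eq]
    refine (integrableOn_exp_neg_half_cos h1 h2 C).mono' ?_ ?_
    · have := measurable_hankelIntegrand φ ω 1
      have := measurable_rayPoint φ 1
      exact (by fun_prop : Measurable fun u => ‖hankelIntegrand φ ω 1 u‖ *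
        Real.exp (|x| * ‖rayPoint φ 1 u‖ ^ α)).aestronglyMeasurable
    · refine (ae_restrict_iff' measurableSet_Ioi).2 (.of_forall fun u hu => ?_)
      rw [Real.norm_of_nonneg (by positivity), norm_hankelIntegrand, mul_assoc]
      exact hC 1 u le_rfl le_rfl (le_of_lt hu)
  · refine (ae_restrict_iff' measurableSet_Ioi).2 (.of_forall fun u hu => ?_)
    have hu : (0 : ℝ) < u := hu
    rw [Complex.exp_eq_exp_ℂ]
    have h3 := (NormedSpace.expSeries_div_hasSum_exp
      ((x : ℂ) * rayPoint φ 1 u ^ (α : ℂ))).mul_left (hankelIntegrand φ ω 1 u)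
    refine h3.congr_fun fun k => ?_
    rw [hankelIntegrand_sub_mul h0 h2 (by linarith) hu.le, mul_pow]
    push_cast
    ring

theorem integral_pow_mul_cexp_neg_mul (j : ℕ) {w : ℂ} (hw : 0 < w.re) :
    ∫ x in Set.Ioi (0 : ℝ), (x : ℂ) ^ j * Complex.exp (-w * x) = j.factorial / w ^ (j + 1) := by
  have hw0 : w ≠ 0 := by rintro rfl; simp at hw
  have h := cpow_mul_integral_rpow_mul_cexp (a := j + 1) (by positivity) hw
  rw [Real.Gamma_nat_eq_factorial] at h
  rw [eq_div_iff (pow_ne_zero _ hw0), mul_comm, ← Complex.cpow_natCast]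
  push_cast at h ⊢
  rw [← h]
  congr 1
  refine setIntegral_congr_fun measurableSet_Ioi fun x _ => ?_
  simp

/-- By Fubini the `x`-integral comes first and gives `j! / z^{α(j+1)}`. This shifts the Hankel
exponent from `1 - α` to `αj + 1`, and Hankel's formula applies a second time. -/
theorem wright_moment {α : ℝ} (hα : 0 < α) (hα1 : α < 1) (j : ℕ) :
    IntegrableOn (fun x : ℝ => x ^ j * wright (-α) (1 - α) (-x)) (Set.Ioi 0) ∧
    ∫ x in Set.Ioi (0 : ℝ), x ^ j * wright (-α) (1 - α) (-x) =
      j.factorial / Real.Gamma (α * j + 1) := by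
  obtain ⟨φ, h1, h2, h3⟩ := exists_angle hα hα1
  have h0 : 0 < φ := by linarith [Real.pi_pos]
  obtain ⟨δ, hδ, hre⟩ := exists_le_re_rayPoint_cpow hα h0 h2 h3 one_pos
  set F : ℝ → ℝ → ℂ := fun x u => (x : ℂ) ^ j * (hankelIntegrand φ (1 - α) 1 u *
    Complex.exp ((-x : ℝ) * rayPoint φ 1 u ^ (α : ℂ))) with hF
  have hW : ∀ x : ℝ, x ^ j * wright (-α) (1 - α) (-x) =
      (∫ u in Set.Ioi 0, F x u).im / Real.pi := fun x => by
    rw [wright, (hasSum_wright hα1 h1 h2 (1 - α) (-x)).tsum_eq, hF, integral_const_mul,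
      ← Complex.ofReal_pow, Complex.im_ofReal_mul, mul_div_assoc]
  have hint : Integrable (Function.uncurry F)
      ((volume.restrict (Set.Ioi (0 : ℝ))).prod (volume.restrict (Set.Ioi (0 : ℝ)))) := by
    have hA := integrableOn_rpow_mul_exp_neg_mul (s := j)
      (by linarith [(Nat.cast_nonneg j : (0 : ℝ) ≤ j)]) hδ
    have hB := (integrableOn_hankelIntegrand (1 - α) h1 h2 one_pos).norm
    refine (Integrable.mul_prod hA hB).mono' ?_ ?_
    · have := measurable_hankelIntegrand φ (1 - α) 1
      have := measurable_rayPoint φ 1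
      refine Measurable.aestronglyMeasurable ?_
      simp only [hF, Function.uncurry_def]
      fun_prop
    · rw [Measure.prod_restrict]
      refine (ae_restrict_iff' (measurableSet_Ioi.prod measurableSet_Ioi)).2
        (.of_forall fun p hp => ?_)
      obtain ⟨x, u⟩ := p
      have hx : (0 : ℝ) < x := hp.1
      have hu : (0 : ℝ) < u := hp.2
      simp only [Function.uncurry_apply_pair, hF]
      rw [norm_mul, norm_mul, norm_pow, Complex.norm_real, Complex.norm_exp,
        Complex.re_ofReal_mul, Real.norm_of_nonneg hx.le, Real.rpow_natCast]
      have : Real.exp (-x * (rayPoint φ 1 u ^ (α : ℂ)).re) ≤ Real.exp (-δ * x) := by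
        rw [Real.exp_le_exp]
        nlinarith [hre u hu.le]
      calc _ = x ^ j * Real.exp (-x * (rayPoint φ 1 u ^ (α : ℂ)).re) *
            ‖hankelIntegrand φ (1 - α) 1 u‖ := by ring
        _ ≤ _ := by gcongr
  simp only [hW]
  refine ⟨(hint.integral_prod_left.im).div_const _, ?_⟩
  have e1 : ∫ x in Set.Ioi (0 : ℝ), (∫ u in Set.Ioi 0, F x u).im / Real.pi =
      (∫ x in Set.Ioi (0 : ℝ), ∫ u in Set.Ioi 0, F x u).im / Real.pi := by
    rw [integral_div]
    congr 1
    exact integral_im hint.integral_prod_left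
  rw [e1, integral_integral_swap hint]
  have e2 : ∫ u in Set.Ioi (0 : ℝ), ∫ x in Set.Ioi (0 : ℝ), F x u =
      ∫ u in Set.Ioi (0 : ℝ), ((j.factorial : ℝ) : ℂ) * hankelIntegrand φ (α * j + 1) 1 u := by
    refine setIntegral_congr_fun measurableSet_Ioi fun u hu => ?_
    have hu : (0 : ℝ) < u := hu
    have hz := hδ.trans_le (hre u hu.le)
    have hz0 : rayPoint φ 1 u ^ (α : ℂ) ≠ 0 := fun h => by simp [h] at hz
    have e3 : ∀ x : ℝ, F x u = hankelIntegrand φ (1 - α) 1 u *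
        ((x : ℂ) ^ j * Complex.exp (-(rayPoint φ 1 u ^ (α : ℂ)) * x)) := fun x => by
      simp only [hF]
      rw [show ((-x : ℝ) : ℂ) * rayPoint φ 1 u ^ (α : ℂ) = -(rayPoint φ 1 u ^ (α : ℂ)) * x by
        push_cast; ring]
      ring
    simp only [e3]
    rw [integral_const_mul, integral_pow_mul_cexp_neg_mul j hz,
      ← hankelIntegrand_add_mul h0 h2 (by linarith) hu.le (1 - α) α (j + 1)]
    rw [show 1 - α + α * ((j + 1 : ℕ) : ℝ) = α * j + 1 by push_cast; ring]
    field_simp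
    push_cast
    ring
  rw [e2, integral_const_mul, Complex.im_ofReal_mul, im_integral_hankelIntegrand _ h1 h2]
  field_simp

/-! ### The law of the random time -/

theorem foldedSolution_of_pos {α x t : ℝ} (hx : 0 < x) (ht : 0 < t) : foldedSolution α x t =
    (t ^ α)⁻¹ * wright (-α) (1 - α) (-((t ^ α)⁻¹ * x)) := by
  have : 0 < t ^ α := by positivity
  rw [foldedSolution, if_pos hx, diffusionSolution, abs_of_pos hx,
    show -x / t ^ α = -((t ^ α)⁻¹ * x) by field_simp]
  field_simp

theorem foldedSolution_moment {α t : ℝ} (hα : 0 < α) (hα1 : α < 1) (ht : 0 < t) (j : ℕ) :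
    Integrable (fun x : ℝ => x ^ j * foldedSolution α x t) ∧
    ∫ x : ℝ, x ^ j * foldedSolution α x t =
      j.factorial * t ^ (α * j) / Real.Gamma (α * j + 1) := by
  have hs : 0 < t ^ α := by positivity
  obtain ⟨h1, h2⟩ := wright_moment hα hα1 j
  have e0 : (fun x : ℝ => x ^ j * foldedSolution α x t) =
      (Set.Ioi 0).indicator fun x => (t ^ α) ^ j * (t ^ α)⁻¹ *
        (fun y => y ^ j * wright (-α) (1 - α) (-y)) ((t ^ α)⁻¹ * x) := by
    funext x
    by_cases hx : 0 < x
    · rw [Set.indicator_of_mem (Set.mem_Ioi.2 hx), foldedSolution_of_pos hx ht]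
      simp only [mul_pow, inv_pow]
      field_simp
    · rw [Set.indicator_of_notMem (by simpa using hx), foldedSolution, if_neg hx, mul_zero]
  rw [e0]
  constructor
  · rw [integrable_indicator_iff measurableSet_Ioi]
    refine Integrable.const_mul ?_ _
    have := (integrableOn_Ioi_comp_mul_left_iff
      (fun y : ℝ => y ^ j * wright (-α) (1 - α) (-y)) 0 (inv_pos.2 hs)).2
    rw [mul_zero] at this
    exact this h1
  · rw [integral_indicator measurableSet_Ioi, integral_const_mul,
      integral_comp_mul_left_Ioi (fun y : ℝ => y ^ j * wright (-α) (1 - α) (-y)) 0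
        (inv_pos.2 hs), mul_zero, h2, Real.rpow_mul ht.le, Real.rpow_natCast, smul_eq_mul]
    field_simp

/-- The positive part and the function have the same integral, so the negative part has integral 0.
-/
theorem ae_nonneg_of_integral_eq_one {X : Type*} [MeasurableSpace X] {μ : Measure X} {f : X → ℝ}
    (hf : Integrable f μ) (h1 : ∫ x, f x ∂μ = 1) (h2 : ∫⁻ x, ENNReal.ofReal (f x) ∂μ = 1) :
    0 ≤ᵐ[μ] f := by
  have h3 := integral_eq_lintegral_pos_part_sub_lintegral_neg_part hf
  rw [h1, h2, ENNReal.toReal_one] at h3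
  have hfin : ∫⁻ x, ENNReal.ofReal (-f x) ∂μ ≠ ⊤ := hf.neg.lintegral_lt_top.ne
  have h4 : ∫⁻ x, ENNReal.ofReal (-f x) ∂μ = 0 := by
    rcases (ENNReal.toReal_eq_zero_iff _).1 (by linarith :
      (∫⁻ x, ENNReal.ofReal (-f x) ∂μ).toReal = 0) with h | h
    · exact h
    · exact absurd h hfin
  have hm : AEMeasurable (fun x => ENNReal.ofReal (-f x)) μ :=
    hf.aestronglyMeasurable.aemeasurable.neg.ennreal_ofReal
  rw [lintegral_eq_zero_iff' hm] at h4
  filter_upwards [h4] with x hx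
  have : -f x ≤ 0 := by simpa using hx
  simpa using this

theorem randomTimeLaw_moment {α t : ℝ} (hα : 0 < α) (hα1 : α ≤ 1) (ht : 0 < t)
    [IsProbabilityMeasure (randomTimeLaw α t)] (j : ℕ) :
    Integrable (fun x : ℝ => x ^ j) (randomTimeLaw α t) ∧
    ∫ x : ℝ, x ^ j ∂randomTimeLaw α t =
      j.factorial * t ^ (α * j) / Real.Gamma (α * j + 1) := by
  rcases hα1.eq_or_lt with rfl | hα1
  · rw [randomTimeLaw, if_pos rfl]
    refine ⟨integrable_dirac (by simp), ?_⟩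
    rw [integral_dirac, one_mul, Real.Gamma_nat_eq_factorial, Real.rpow_natCast]
    field_simp
  · have hprob := measure_univ (μ := randomTimeLaw α t)
    rw [randomTimeLaw, if_neg hα1.ne] at hprob ⊢
    rw [withDensity_apply _ MeasurableSet.univ, Measure.restrict_univ] at hprob
    obtain ⟨h1, h2⟩ := foldedSolution_moment hα hα1 ht 0
    simp only [pow_zero, one_mul, Nat.cast_zero, mul_zero, zero_add, Nat.factorial_zero,
      Nat.cast_one, Real.rpow_zero, Real.Gamma_one, div_one] at h1 h2
    -- `ENNReal.ofReal` truncates negative values, so the moments of the law are those of the folded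
    -- solution only once the latter is known to be nonnegative a.e.
    have hnn := ae_nonneg_of_integral_eq_one h1 h2 hprob
    have hm : AEMeasurable (fun x => ENNReal.ofReal (foldedSolution α x t)) :=
      h1.aestronglyMeasurable.aemeasurable.ennreal_ofReal
    have he : (fun x : ℝ => (ENNReal.ofReal (foldedSolution α x t)).toReal • x ^ j) =ᵐ[volume]
        fun x => x ^ j * foldedSolution α x t := by
      filter_upwards [hnn] with x hx
      rw [ENNReal.toReal_ofReal hx, smul_eq_mul, mul_comm]
    obtain ⟨h3, h4⟩ := foldedSolution_moment hα hα1 ht j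
    have hlt : ∀ᵐ x : ℝ, ENNReal.ofReal (foldedSolution α x t) < ⊤ :=
      .of_forall fun _ => ENNReal.ofReal_lt_top
    constructor
    · rw [integrable_withDensity_iff_integrable_smul₀' hm hlt]
      exact h3.congr he.symm
    · rw [integral_withDensity_eq_integral_toReal_smul₀ hm hlt, integral_congr_ae he, h4]

theorem randomTimeLaw_ae_pos {α t : ℝ} (ht : 0 < t) : ∀ᵐ x ∂randomTimeLaw α t, 0 < x := by
  rw [randomTimeLaw]
  split_ifs
  · rw [ae_dirac_iff measurableSet_Ioi]; exact ht
  · rw [ae_iff]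
    have : {a : ℝ | ¬0 < a} = Set.Iic 0 := by ext; simp
    rw [this, withDensity_apply _ measurableSet_Iic]
    refine (setLIntegral_congr_fun measurableSet_Iic fun x hx => ?_).trans lintegral_zero
    rw [foldedSolution, if_neg (not_lt.2 hx), ENNReal.ofReal_zero]

/-! ### Mittag-Leffler series -/

/-- A sequence of at most geometric growth. -/
def GeomBounded (a : ℕ → ℝ) : Prop := ∃ C R : ℝ, 0 ≤ C ∧ 0 ≤ R ∧ ∀ j, |a j| ≤ C * R ^ j

/-- The series `∑ a_j t^{αj} / Γ(αj+1)`. -/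
noncomputable def mlSeries (α : ℝ) (a : ℕ → ℝ) (t : ℝ) : ℝ :=
  ∑' j : ℕ, a j * (t ^ (α * j) / Real.Gamma (α * j + 1))

/-- The series `∑ a_j t^{αj-1} / Γ(αj)`, the derivative of `mlSeries`. -/
noncomputable def mlDerivSeries (α : ℝ) (a : ℕ → ℝ) (t : ℝ) : ℝ :=
  ∑' j : ℕ, a j * (t ^ (α * j - 1) / Real.Gamma (α * j))

/-- The Cauchy product of two sequences. -/
def cauchyProd (a b : ℕ → ℝ) (n : ℕ) : ℝ :=
  ∑ p ∈ Finset.HasAntidiagonal.antidiagonal n, a p.1 * b p.2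

theorem GeomBounded.mul_pow {a : ℕ → ℝ} (ha : GeomBounded a) (s : ℝ) :
    GeomBounded fun j => a j * s ^ j := by
  obtain ⟨C, R, hC, hR, h⟩ := ha
  refine ⟨C, R * |s|, hC, by positivity, fun j => ?_⟩
  rw [abs_mul, abs_pow, _root_.mul_pow, ← mul_assoc]
  exact mul_le_mul_of_nonneg_right (h j) (by positivity)

theorem GeomBounded.sub {a b : ℕ → ℝ} (ha : GeomBounded a) (hb : GeomBounded b) :
    GeomBounded fun j => a j - b j := by
  obtain ⟨C, R, hC, hR, h⟩ := ha
  obtain ⟨C', R', hC', hR', h'⟩ := hb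
  refine ⟨C + C', max R R', by positivity, by positivity, fun j => (abs_sub _ _).trans ?_⟩
  rw [add_mul]
  refine add_le_add ((h j).trans ?_) ((h' j).trans ?_)
  · gcongr; exact le_max_left _ _
  · gcongr; exact le_max_right _ _

theorem GeomBounded.cauchyProd {a b : ℕ → ℝ} (ha : GeomBounded a) (hb : GeomBounded b) :
    GeomBounded (cauchyProd a b) := by
  obtain ⟨C, R, hC, hR, h⟩ := ha
  obtain ⟨C', R', hC', hR', h'⟩ := hb
  refine ⟨C * C', 2 * max R R', by positivity, by positivity, fun n => ?_⟩
  refine (Finset.abs_sum_le_sum_abs _ _).trans ?_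
  have h1 : ∀ p ∈ Finset.HasAntidiagonal.antidiagonal n, |a p.1 * b p.2| ≤ C * C' * max R R' ^ n := by
    intro p hp
    rw [← Finset.HasAntidiagonal.mem_antidiagonal.1 hp, abs_mul, pow_add]
    calc |a p.1| * |b p.2| ≤ (C * max R R' ^ p.1) * (C' * max R R' ^ p.2) := by
          refine mul_le_mul ((h _).trans ?_) ((h' _).trans ?_) (abs_nonneg _) (by positivity)
          · gcongr; exact le_max_left _ _
          · gcongr; exact le_max_right _ _
      _ = _ := by ring
  refine (Finset.sum_le_card_nsmul _ _ _ h1).trans ?_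
  rw [Finset.Nat.card_antidiagonal, nsmul_eq_mul, _root_.mul_pow]
  have h2 : ((n + 1 : ℕ) : ℝ) ≤ 2 ^ n := by exact_mod_cast Nat.lt_two_pow_self
  have h3 : 0 ≤ C * C' * max R R' ^ n := by positivity
  nlinarith

/-- Keep only the part `x > K` of the Gamma integral, where `x^s ≥ K^s`. As `K` is free, this shows
that `Γ(αj+1)` outgrows every geometric sequence. -/
theorem rpow_mul_exp_neg_le_Gamma {K s : ℝ} (hK : 0 ≤ K) (hs : 0 ≤ s) :
    K ^ s * Real.exp (-K) ≤ Real.Gamma (s + 1) := by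
  rw [Real.Gamma_eq_integral (by linarith), add_sub_cancel_right]
  have hint : IntegrableOn (fun x : ℝ => Real.exp (-x) * x ^ s) (Set.Ioi 0) := by
    simpa using Real.GammaIntegral_convergent (s := s + 1) (by linarith)
  calc K ^ s * Real.exp (-K) = ∫ x in Set.Ioi K, Real.exp (-x) * K ^ s := by
        rw [integral_mul_const, integral_exp_neg_Ioi, mul_comm]
    _ ≤ ∫ x in Set.Ioi K, Real.exp (-x) * x ^ s := by
        refine setIntegral_mono_on ((integrableOn_exp_neg_Ioi K).mul_const _)
          (hint.mono_set (Set.Ioi_subset_Ioi hK)) measurableSet_Ioi fun x hx => ?_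
        have : K < x := hx
        gcongr
    _ ≤ _ := by
        refine setIntegral_mono_set hint ?_ (Set.Ioi_subset_Ioi hK).eventuallyLE
        refine (ae_restrict_iff' measurableSet_Ioi).2 (.of_forall fun x hx => ?_)
        have : (0 : ℝ) < x := hx
        simp only [Pi.zero_apply]
        positivity

theorem exists_pow_div_Gamma_le {α ρ : ℝ} (hα : 0 < α) (hρ : 0 ≤ ρ) :
    ∃ D, 0 ≤ D ∧ ∀ j : ℕ, ρ ^ j / Real.Gamma (α * j + 1) ≤ D * (1 / 2) ^ j := by
  -- Chosen so that `K^{αj} = (2ρ)^j`; the extra `2^j` is the geometric gain.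
  set K := (2 * ρ) ^ α⁻¹ with hK
  have hK0 : 0 ≤ K := by positivity
  refine ⟨Real.exp K, by positivity, fun j => ?_⟩
  have h := rpow_mul_exp_neg_le_Gamma hK0 (s := α * j) (by positivity)
  have h1 : K ^ (α * j) = 2 ^ j * ρ ^ j := by
    rw [hK, ← Real.rpow_mul (by positivity), inv_mul_cancel_left₀ hα.ne', Real.rpow_natCast,
      mul_pow]
  rw [h1, Real.exp_neg] at h
  have hG : 0 < Real.Gamma (α * j + 1) := Real.Gamma_pos_of_pos (by positivity)
  rw [div_le_iff₀ hG, one_div, inv_pow]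
  have h2 := mul_le_mul_of_nonneg_left h (by positivity : 0 ≤ Real.exp K * ((2 : ℝ) ^ j)⁻¹)
  calc ρ ^ j = Real.exp K * ((2 : ℝ) ^ j)⁻¹ * (2 ^ j * ρ ^ j * (Real.exp K)⁻¹) := by
        field_simp
    _ ≤ _ := h2

theorem GeomBounded.exists_abs_mul_div_Gamma_le {a : ℕ → ℝ} (ha : GeomBounded a) {α ρ : ℝ}
    (hα : 0 < α) (hρ : 0 ≤ ρ) :
    ∃ D, 0 ≤ D ∧ ∀ j : ℕ, |a j| * (ρ ^ j / Real.Gamma (α * j + 1)) ≤ D * (1 / 2) ^ j := by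
  obtain ⟨C, R, hC, hR, h⟩ := ha
  obtain ⟨D, hD, h'⟩ := exists_pow_div_Gamma_le (ρ := R * ρ) hα (by positivity)
  refine ⟨C * D, by positivity, fun j => ?_⟩
  have hG : 0 < Real.Gamma (α * j + 1) := Real.Gamma_pos_of_pos (by positivity)
  calc _ ≤ C * R ^ j * (ρ ^ j / Real.Gamma (α * j + 1)) :=
        mul_le_mul_of_nonneg_right (h j) (by positivity)
    _ = C * ((R * ρ) ^ j / Real.Gamma (α * j + 1)) := by rw [_root_.mul_pow]; ring
    _ ≤ _ := by rw [mul_assoc]; exact mul_le_mul_of_nonneg_left (h' j) hC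

theorem GeomBounded.summable_pow {a : ℕ → ℝ} (ha : GeomBounded a) {α ρ : ℝ}
    (hα : 0 < α) (hρ : 0 ≤ ρ) :
    Summable fun j : ℕ => |a j| * (ρ ^ j / Real.Gamma (α * j + 1)) := by
  obtain ⟨D, -, h⟩ := ha.exists_abs_mul_div_Gamma_le hα hρ
  refine Summable.of_nonneg_of_le (fun j => ?_) h (summable_geometric_two.mul_left D)
  have hG : 0 < Real.Gamma (α * j + 1) := Real.Gamma_pos_of_pos (by positivity)
  positivity

/-- At `x = 0` both sides are 0 since `Real.Gamma 0 = 0`. Hence the `j = 0` term of the derivative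
series vanishes, as the derivative of a constant should. -/
theorem inv_Gamma_eq (x : ℝ) : 1 / Real.Gamma x = x / Real.Gamma (x + 1) := by
  by_cases hx : x = 0
  · simp [hx, Real.Gamma_zero]
  · rw [Real.Gamma_add_one hx]; field_simp

theorem GeomBounded.summable_mlSeries {a : ℕ → ℝ} (ha : GeomBounded a) {α t : ℝ}
    (hα : 0 < α) (ht : 0 ≤ t) :
    Summable fun j : ℕ => ‖a j * (t ^ (α * j) / Real.Gamma (α * j + 1))‖ := by
  refine (ha.summable_pow hα (ρ := t ^ α) (by positivity)).congr fun j => ?_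
  have hG : 0 < Real.Gamma (α * j + 1) := Real.Gamma_pos_of_pos (by positivity)
  rw [Real.rpow_mul ht, Real.rpow_natCast, norm_mul, Real.norm_eq_abs, Real.norm_of_nonneg]
  positivity

theorem GeomBounded.exists_deriv_bound {a : ℕ → ℝ} (ha : GeomBounded a) {α ρ : ℝ}
    (hα : 0 < α) (hρ : 0 ≤ ρ) :
    ∃ D, 0 ≤ D ∧ ∀ j : ℕ, |a j| * (ρ ^ j / Real.Gamma (α * j)) ≤ D * (1 / 2) ^ j := by
  obtain ⟨D, hD, h⟩ := ha.exists_abs_mul_div_Gamma_le (ρ := 2 * ρ) hα (by positivity)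
  refine ⟨α * D, by positivity, fun j => ?_⟩
  have hG : 0 < Real.Gamma (α * j + 1) := Real.Gamma_pos_of_pos (by positivity)
  have hj : (j : ℝ) ≤ 2 ^ j := by exact_mod_cast Nat.lt_two_pow_self.le
  calc |a j| * (ρ ^ j / Real.Gamma (α * j))
      = α * (|a j| * (j * ρ ^ j / Real.Gamma (α * j + 1))) := by
        rw [div_eq_mul_one_div (ρ ^ j), inv_Gamma_eq]; ring
    _ ≤ α * (|a j| * ((2 * ρ) ^ j / Real.Gamma (α * j + 1))) := by
        rw [_root_.mul_pow]; gcongr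
    _ ≤ _ := by rw [mul_assoc]; exact mul_le_mul_of_nonneg_left (h j) hα.le

theorem GeomBounded.summable_mlDerivSeries {a : ℕ → ℝ} (ha : GeomBounded a) {α t : ℝ}
    (hα : 0 < α) (ht : 0 < t) :
    Summable fun j : ℕ => ‖a j * (t ^ (α * j - 1) / Real.Gamma (α * j))‖ := by
  obtain ⟨D, hD, h⟩ := ha.exists_deriv_bound (ρ := t ^ α) hα (by positivity)
  refine Summable.of_nonneg_of_le (fun j => norm_nonneg _) (fun j => ?_)
    (summable_geometric_two.mul_left (t⁻¹ * D))
  have hG : 0 ≤ Real.Gamma (α * j) := Real.Gamma_nonneg_of_nonneg (by positivity)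
  calc _ = t⁻¹ * (|a j| * ((t ^ α) ^ j / Real.Gamma (α * j))) := by
        rw [norm_mul, Real.norm_eq_abs, Real.norm_of_nonneg (by positivity),
          Real.rpow_sub_one ht.ne', Real.rpow_mul ht.le, Real.rpow_natCast]
        ring
    _ ≤ _ := by rw [mul_assoc]; exact mul_le_mul_of_nonneg_left (h j) (by positivity)

theorem GeomBounded.hasDerivAt_mlSeries {a : ℕ → ℝ} (ha : GeomBounded a) {α t : ℝ}
    (hα : 0 < α) (ht : 0 < t) : HasDerivAt (mlSeries α a) (mlDerivSeries α a t) t := by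
  obtain ⟨D, hD, h⟩ := ha.exists_deriv_bound (ρ := (2 * t) ^ α) hα (by positivity)
  refine hasDerivAt_tsum_of_isPreconnected (t := Set.Ioo (t / 2) (2 * t))
    (g := fun (j : ℕ) (t : ℝ) => a j * (t ^ (α * j) / Real.Gamma (α * j + 1)))
    (g' := fun (j : ℕ) (t : ℝ) => a j * (t ^ (α * j - 1) / Real.Gamma (α * j)))
    (summable_geometric_two.mul_left ((t / 2)⁻¹ * D)) isOpen_Ioo isPreconnected_Ioo
    ?_ ?_ (y₀ := t) ⟨by linarith, by linarith⟩ ((ha.summable_mlSeries hα ht.le).of_norm)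
    ⟨by linarith, by linarith⟩
  · intro j y hy
    have hy0 : 0 < y := by linarith [hy.1]
    refine (((Real.hasDerivAt_rpow_const (p := α * j) (.inl hy0.ne')).div_const _).const_mul
      (a j)).congr_deriv ?_
    have := inv_Gamma_eq (α * j)
    rw [div_eq_mul_one_div (y ^ (α * j - 1)) (Real.Gamma (α * j)), this]
    ring
  · intro j y hy
    have hy0 : 0 < y := by linarith [hy.1]
    have hG : 0 ≤ Real.Gamma (α * j) := Real.Gamma_nonneg_of_nonneg (by positivity)
    rw [norm_mul, Real.norm_eq_abs, Real.norm_of_nonneg (by positivity),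
      Real.rpow_sub_one hy0.ne', Real.rpow_mul hy0.le, Real.rpow_natCast]
    calc |a j| * ((y ^ α) ^ j / y / Real.Gamma (α * j))
        = y⁻¹ * (|a j| * ((y ^ α) ^ j / Real.Gamma (α * j))) := by ring
      _ ≤ (t / 2)⁻¹ * (|a j| * (((2 * t) ^ α) ^ j / Real.Gamma (α * j))) := by
          have h1 := hy.1.le
          have h2 := hy.2.le
          gcongr
      _ ≤ _ := by rw [mul_assoc]; exact mul_le_mul_of_nonneg_left (h j) (by positivity)

theorem integral_rpow_mul_sub_rpow {p q t : ℝ} (hp : 0 < p) (hq : 0 < q) (ht : 0 < t) :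
    ∫ x in (0 : ℝ)..t, x ^ (p - 1) * (t - x) ^ (q - 1) =
      t ^ (p + q - 1) * (Real.Gamma p * Real.Gamma q / Real.Gamma (p + q)) := by
  have h := Complex.betaIntegral_scaled p q ht
  rw [Complex.betaIntegral_eq_Gamma_mul_div _ _ (by simpa) (by simpa)] at h
  have e : ∫ x in (0 : ℝ)..t, (x : ℂ) ^ ((p : ℂ) - 1) * ((t : ℂ) - x) ^ ((q : ℂ) - 1) =
      ((∫ x in (0 : ℝ)..t, x ^ (p - 1) * (t - x) ^ (q - 1) : ℝ) : ℂ) := by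
    rw [← intervalIntegral.integral_ofReal]
    refine intervalIntegral.integral_congr fun x hx => ?_
    rw [Set.uIcc_of_le ht.le] at hx
    push_cast
    rw [Complex.ofReal_cpow hx.1, Complex.ofReal_cpow (sub_nonneg.2 hx.2)]
    push_cast
    rfl
  rw [e, ← Complex.ofReal_add, Complex.Gamma_ofReal, Complex.Gamma_ofReal,
    Complex.Gamma_ofReal, ← Complex.ofReal_one, ← Complex.ofReal_sub,
    ← Complex.ofReal_cpow ht.le] at h
  exact_mod_cast h

/-- This is the Beta integral; the result depends on `i + j` only. For `j = 0` the kernel is 0 by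
the convention on `1/Γ` and the formula fails. -/
theorem setIntegral_mlTerm_conv {α t : ℝ} (hα : 0 < α) (ht : 0 < t) (i : ℕ) {j : ℕ}
    (hj : j ≠ 0) :
    IntegrableOn (fun x => ((t - x) ^ (α * i) / Real.Gamma (α * i + 1)) *
      (x ^ (α * j - 1) / Real.Gamma (α * j))) (Set.Ioc 0 t) ∧
    ∫ x in Set.Ioc 0 t, ((t - x) ^ (α * i) / Real.Gamma (α * i + 1)) *
      (x ^ (α * j - 1) / Real.Gamma (α * j)) =
      t ^ (α * ((i + j : ℕ) : ℝ)) / Real.Gamma (α * ((i + j : ℕ) : ℝ) + 1) := by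
  have hj' : 0 < α * j := mul_pos hα (by exact_mod_cast Nat.pos_of_ne_zero hj)
  have hi' : 0 ≤ α * i := by positivity
  have hG1 : 0 < Real.Gamma (α * i + 1) := Real.Gamma_pos_of_pos (by positivity)
  have hG2 : 0 < Real.Gamma (α * j) := Real.Gamma_pos_of_pos hj'
  have e : ∀ x : ℝ, ((t - x) ^ (α * i) / Real.Gamma (α * i + 1)) *
      (x ^ (α * j - 1) / Real.Gamma (α * j)) =
      (Real.Gamma (α * i + 1) * Real.Gamma (α * j))⁻¹ *
        (x ^ (α * j - 1) * (t - x) ^ (α * i + 1 - 1)) := fun x => by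
    rw [add_sub_cancel_right]; field_simp
  simp only [e]
  constructor
  · refine Integrable.const_mul ?_ _
    have h1 : IntervalIntegrable (fun x : ℝ => x ^ (α * j - 1)) volume 0 t :=
      intervalIntegral.intervalIntegrable_rpow' (by linarith)
    have h2 : ContinuousOn (fun x : ℝ => (t - x) ^ (α * i + 1 - 1)) (Set.uIcc 0 t) := by
      rw [add_sub_cancel_right]
      exact (Continuous.rpow_const (by fun_prop) fun _ => .inr hi').continuousOn
    exact (intervalIntegrable_iff_integrableOn_Ioc_of_le ht.le).1 (h1.mul_continuousOn h2)
  · rw [integral_const_mul, ← intervalIntegral.integral_of_le ht.le,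
      integral_rpow_mul_sub_rpow hj' (by linarith) ht]
    rw [show α * j + (α * i + 1) - 1 = α * ((i + j : ℕ) : ℝ) by push_cast; ring,
      show α * j + (α * i + 1) = α * ((i + j : ℕ) : ℝ) + 1 by push_cast; ring]
    field_simp

/-- Each product of terms integrates to a function of `i + j`, so the double series regroups along
antidiagonals. The condition `b 0 = 0` avoids the exceptional kernel `j = 0`. -/
theorem setIntegral_mlSeries_mul_mlDerivSeries {a b : ℕ → ℝ} (ha : GeomBounded a)
    (hb : GeomBounded b) (hb0 : b 0 = 0) {α t : ℝ} (hα : 0 < α) (ht : 0 < t) :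
    ∫ x in Set.Ioc 0 t, mlSeries α a (t - x) * mlDerivSeries α b x =
      mlSeries α (cauchyProd a b) t := by
  set g : ℕ × ℕ → ℝ → ℝ := fun p x => ((t - x) ^ (α * p.1) / Real.Gamma (α * p.1 + 1)) *
    (x ^ (α * p.2 - 1) / Real.Gamma (α * p.2)) with hg
  set F : ℕ × ℕ → ℝ → ℝ := fun p x => a p.1 * b p.2 * g p x with hF
  have hFint : ∀ p, IntegrableOn (F p) (Set.Ioc 0 t) ∧ ∫ x in Set.Ioc 0 t, F p x =
      a p.1 * b p.2 *
        (t ^ (α * ((p.1 + p.2 : ℕ) : ℝ)) / Real.Gamma (α * ((p.1 + p.2 : ℕ) : ℝ) + 1)) := by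
    rintro ⟨i, j⟩
    by_cases hj : j = 0
    · subst hj
      simp [hF, hb0]
    · obtain ⟨h1, h2⟩ := setIntegral_mlTerm_conv hα ht i hj
      exact ⟨h1.const_mul _, by rw [← h2]; exact integral_const_mul _ _⟩
  have hgnn : ∀ p, ∀ x ∈ Set.Ioc 0 t, 0 ≤ g p x := fun p x hx => by
    have h1 : 0 ≤ t - x := sub_nonneg.2 hx.2
    have h2 : 0 < x := hx.1
    have hG1 : 0 < Real.Gamma (α * p.1 + 1) := Real.Gamma_pos_of_pos (by positivity)
    have hG2 : 0 ≤ Real.Gamma (α * p.2) := Real.Gamma_nonneg_of_nonneg (by positivity)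
    positivity
  have hnorm : ∀ p, ∫ x in Set.Ioc 0 t, ‖F p x‖ = |a p.1| * |b p.2| *
        (t ^ (α * ((p.1 + p.2 : ℕ) : ℝ)) / Real.Gamma (α * ((p.1 + p.2 : ℕ) : ℝ) + 1)) := by
    intro p
    have h1 : ∫ x in Set.Ioc 0 t, ‖F p x‖ = ∫ x in Set.Ioc 0 t, |a p.1| * |b p.2| * g p x := by
      refine setIntegral_congr_fun measurableSet_Ioc fun x hx => ?_
      simp only [hF]
      rw [norm_mul, norm_mul, Real.norm_of_nonneg (hgnn p x hx), Real.norm_eq_abs,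
        Real.norm_eq_abs]
    obtain ⟨i, j⟩ := p
    rw [h1, integral_const_mul]
    by_cases hj : j = 0
    · subst hj
      simp [hb0]
    · rw [(setIntegral_mlTerm_conv hα ht i hj).2]
  have hsumm : Summable fun p : ℕ × ℕ => |a p.1| * |b p.2| *
        (t ^ (α * ((p.1 + p.2 : ℕ) : ℝ)) / Real.Gamma (α * ((p.1 + p.2 : ℕ) : ℝ) + 1)) := by
    obtain ⟨C, R, hC, hR, h⟩ := ha
    obtain ⟨C', R', hC', hR', h'⟩ := hb
    set M := max R R' with hM
    obtain ⟨D, hD, hD'⟩ := exists_pow_div_Gamma_le (ρ := M * t ^ α) hα (by positivity)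
    have hgeo : Summable fun p : ℕ × ℕ => ((1 / 2 : ℝ) ^ p.1) * ((1 / 2 : ℝ) ^ p.2) :=
      summable_geometric_two.mul_of_nonneg summable_geometric_two (fun _ => by positivity)
        (fun _ => by positivity)
    refine Summable.of_nonneg_of_le (fun p => ?_) (fun p => ?_) (hgeo.mul_left (C * C' * D))
    · have hG : 0 < Real.Gamma (α * ((p.1 + p.2 : ℕ) : ℝ) + 1) :=
        Real.Gamma_pos_of_pos (by positivity)
      positivity
    · have hG : 0 < Real.Gamma (α * ((p.1 + p.2 : ℕ) : ℝ) + 1) :=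
        Real.Gamma_pos_of_pos (by positivity)
      have h1 : |a p.1| ≤ C * M ^ p.1 := (h _).trans (by gcongr; exact le_max_left _ _)
      have h2 : |b p.2| ≤ C' * M ^ p.2 := (h' _).trans (by gcongr; exact le_max_right _ _)
      have hM0 : 0 ≤ M := by positivity
      calc _ ≤ (C * M ^ p.1) * (C' * M ^ p.2) *
            (t ^ (α * ((p.1 + p.2 : ℕ) : ℝ)) / Real.Gamma (α * ((p.1 + p.2 : ℕ) : ℝ) + 1)) := by
            gcongr
        _ = C * C' * ((M * t ^ α) ^ (p.1 + p.2) /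
              Real.Gamma (α * ((p.1 + p.2 : ℕ) : ℝ) + 1)) := by
            rw [Real.rpow_mul ht.le, Real.rpow_natCast, mul_pow, pow_add M]; ring
        _ ≤ C * C' * (D * (1 / 2) ^ (p.1 + p.2)) := by
            gcongr; exact hD' _
        _ = _ := by rw [pow_add]; ring
  have key := hasSum_integral_of_summable_integral_norm (fun p => (hFint p).1)
    (by simpa only [hnorm] using hsumm)
  have e1 : ∫ x in Set.Ioc 0 t, ∑' p, F p x =
      ∫ x in Set.Ioc 0 t, mlSeries α a (t - x) * mlDerivSeries α b x := by
    rw [integral_Ioc_eq_integral_Ioo, integral_Ioc_eq_integral_Ioo]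
    refine setIntegral_congr_fun measurableSet_Ioo fun x hx => ?_
    simp only [mlSeries, mlDerivSeries]
    rw [tsum_mul_tsum_of_summable_norm (ha.summable_mlSeries hα (sub_nonneg.2 hx.2.le))
      (hb.summable_mlDerivSeries hα hx.1)]
    refine tsum_congr fun p => ?_
    simp only [hF, hg]
    ring
  rw [e1] at key
  simp only [fun p => (hFint p).2] at key
  have h1 := ((Finset.HasAntidiagonal.sigmaAntidiagonalEquivProd (A := ℕ)).hasSum_iff.2 key).sigma
    (fun n => hasSum_fintype _)
  rw [mlSeries, ← h1.tsum_eq]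
  refine tsum_congr fun n => ?_
  rw [cauchyProd, Finset.sum_mul, ← Finset.sum_coe_sort (Finset.HasAntidiagonal.antidiagonal n)
    (fun p => a p.1 * b p.2 * (t ^ (α * n) / Real.Gamma (α * n + 1)))]
  refine Fintype.sum_congr _ _ fun p => ?_
  have := Finset.HasAntidiagonal.mem_antidiagonal.1 p.2
  simp only [Function.comp_apply, Finset.HasAntidiagonal.sigmaAntidiagonalEquivProd_apply, this]

/-! ### The interarrival density and its relation to the random time -/

/-- The coefficients of `(rX / (1 + rX))²`. -/
def interarrivalCoeff (r : ℝ) : ℕ → ℝ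
  | 0 => 0
  | 1 => 0
  | j + 2 => r ^ 2 * ((j + 1) * (-r) ^ j)

/-- The coefficients of `(rX / (1 + rX))^{2n}`. -/
def renewalCoeff (r : ℝ) : ℕ → ℕ → ℝ
  | 0 => fun j => if j = 0 then 1 else 0
  | n + 1 => cauchyProd (renewalCoeff r n) (interarrivalCoeff r)

theorem geomBounded_interarrivalCoeff (r : ℝ) : GeomBounded (interarrivalCoeff r) := by
  refine ⟨r ^ 2, 2 * |r| + 1, by positivity, by positivity, fun j => ?_⟩
  match j with
  | 0 => simp only [interarrivalCoeff, abs_zero]; positivity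
  | 1 => simp only [interarrivalCoeff, abs_zero]; positivity
  | j + 2 =>
    have h1 : (j : ℝ) + 1 ≤ 2 ^ j := by exact_mod_cast Nat.lt_two_pow_self
    rw [interarrivalCoeff, abs_mul, abs_mul, abs_pow, abs_pow, abs_neg, sq_abs,
      abs_of_nonneg (by positivity : (0 : ℝ) ≤ j + 1)]
    gcongr
    calc ((j : ℝ) + 1) * |r| ^ j ≤ 2 ^ j * |r| ^ j := by gcongr
      _ = (2 * |r|) ^ j := by rw [mul_pow]
      _ ≤ (2 * |r| + 1) ^ j := by gcongr; linarith
      _ ≤ (2 * |r| + 1) ^ (j + 2) :=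
          pow_le_pow_right₀ (by linarith [abs_nonneg r]) (by omega)

theorem geomBounded_renewalCoeff (r : ℝ) (n : ℕ) : GeomBounded (renewalCoeff r n) := by
  induction n with
  | zero =>
    refine ⟨1, 1, zero_le_one, zero_le_one, fun j => ?_⟩
    simp only [renewalCoeff]
    split_ifs <;> simp
  | succ n ih => exact ih.cauchyProd (geomBounded_interarrivalCoeff r)

/-- Shift the index by 2 and use `Γ(j+2)/j! = j+1`. The point is that the coefficients are free of
`α`. -/
theorem interarrivalDensity_eq_mlDerivSeries {α x : ℝ} (r : ℝ) (hα : 0 < α) (hx : 0 < x) :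
    interarrivalDensity α r x = mlDerivSeries α (interarrivalCoeff r) x := by
  have hs := ((geomBounded_interarrivalCoeff r).summable_mlDerivSeries hα hx).of_norm
  rw [interarrivalDensity, if_pos hx, mlDerivSeries, ← hs.sum_add_tsum_nat_add 2, mittagLeffler,
    Real.Gamma_two, div_one, one_mul, ← tsum_mul_left]
  simp only [Finset.sum_range_succ, Finset.sum_range_zero, interarrivalCoeff, zero_mul, add_zero,
    zero_add]
  refine tsum_congr fun j => ?_
  have h1 : Real.Gamma (j + 2) = (j + 1) * j.factorial := by
    rw [show (j : ℝ) + 2 = j + 1 + 1 by ring, Real.Gamma_add_one (by positivity),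
      Real.Gamma_nat_eq_factorial]
  have h2 : α * ((j + 2 : ℕ) : ℝ) - 1 = (2 * α - 1) + α * j := by push_cast; ring
  rw [h1, h2, Real.rpow_add hx, Real.rpow_mul hx.le, Real.rpow_natCast, mul_pow,
    show (j : ℝ) * α + 2 * α = α * ((j + 2 : ℕ) : ℝ) by push_cast; ring]
  have : (j.factorial : ℝ) ≠ 0 := by positivity
  field_simp

theorem mlSeries_one_apply (a : ℕ → ℝ) {x : ℝ} :
    mlSeries 1 a x = ∑' j : ℕ, a j * (x ^ j / j.factorial) := by
  refine tsum_congr fun j => ?_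
  rw [one_mul, Real.rpow_natCast, Real.Gamma_nat_eq_factorial]

theorem interarrivalDensity_one {r x : ℝ} (hx : 0 < x) :
    interarrivalDensity 1 r x = r ^ 2 * x * Real.exp (-r * x) := by
  have h : mittagLeffler 1 (2 * 1) 2 (-r * x ^ (1 : ℝ)) = Real.exp (-r * x) := by
    rw [mittagLeffler, Real.Gamma_two, div_one, one_mul, Real.rpow_one, Real.exp_eq_exp_ℝ,
      NormedSpace.exp_eq_tsum_div]
    refine tsum_congr fun j => ?_
    have h1 : (0 : ℝ) < Real.Gamma (j + 2) := Real.Gamma_pos_of_pos (by positivity)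
    rw [mul_one, mul_one]
    field_simp
  rw [interarrivalDensity, if_pos hx, h]
  norm_num

theorem integral_mlSeries_one {ν : Measure ℝ} {α τ : ℝ} {a : ℕ → ℝ} (hα : 0 < α) (hτ : 0 ≤ τ)
    (ha : GeomBounded a) (hpos : ∀ᵐ x ∂ν, 0 < x)
    (hm : ∀ j : ℕ, Integrable (fun x : ℝ => x ^ j) ν ∧
      ∫ x, x ^ j ∂ν = j.factorial * τ ^ j / Real.Gamma (α * j + 1)) :
    ∫ x, mlSeries 1 a x ∂ν = ∑' j : ℕ, a j * (τ ^ j / Real.Gamma (α * j + 1)) := by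
  have e1 : ∀ (c : ℝ) (j : ℕ), ∫ x, c * (x ^ j / j.factorial) ∂ν =
      c * (τ ^ j / Real.Gamma (α * j + 1)) := fun c j => by
    rw [integral_const_mul, integral_div, (hm j).2]
    have : (j.factorial : ℝ) ≠ 0 := by positivity
    field_simp
  have e2 : ∀ j : ℕ, ∫ x, ‖a j * (x ^ j / j.factorial)‖ ∂ν =
      |a j| * (τ ^ j / Real.Gamma (α * j + 1)) := fun j => by
    rw [← e1 |a j| j]
    refine integral_congr_ae ?_
    filter_upwards [hpos] with x hx
    rw [norm_mul, Real.norm_eq_abs, Real.norm_of_nonneg (by positivity)]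
  have key := hasSum_integral_of_summable_integral_norm
    (F := fun (j : ℕ) (x : ℝ) => a j * (x ^ j / j.factorial)) (μ := ν)
    (fun j => ((hm j).1.div_const _).const_mul _)
    (by simpa only [e2] using ha.summable_pow hα hτ)
  simp only [e1] at key
  simp only [mlSeries_one_apply]
  exact key.tsum_eq.symm

/-- The heart of the subordination: taking the expectation replaces `x^j / j!` by `t^{αj} / Γ(αj+1)`
and leaves the coefficients alone. -/
theorem integral_mlSeries_randomTimeLaw {α t : ℝ} (hα : 0 < α) (hα1 : α ≤ 1) (ht : 0 < t)
    [IsProbabilityMeasure (randomTimeLaw α t)] {a : ℕ → ℝ} (ha : GeomBounded a) :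
    ∫ x, mlSeries 1 a x ∂randomTimeLaw α t = mlSeries α a t := by
  have e : ∀ j : ℕ, t ^ (α * j) = (t ^ α) ^ j := fun j => by
    rw [Real.rpow_mul ht.le, Real.rpow_natCast]
  rw [integral_mlSeries_one hα (τ := t ^ α) (by positivity) ha (randomTimeLaw_ae_pos ht)
    fun j => by rw [← e]; exact randomTimeLaw_moment hα hα1 ht j]
  exact tsum_congr fun j => by rw [e]

theorem monotoneOn_mlSeries_one {r : ℝ} :
    MonotoneOn (mlSeries 1 (interarrivalCoeff r)) (Set.Ioi 0) := by
  have hd : ∀ x ∈ Set.Ioi (0 : ℝ), HasDerivAt (mlSeries 1 (interarrivalCoeff r))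
      (r ^ 2 * x * Real.exp (-r * x)) x := fun x hx => by
    rw [← interarrivalDensity_one hx, interarrivalDensity_eq_mlDerivSeries r one_pos hx]
    exact (geomBounded_interarrivalCoeff r).hasDerivAt_mlSeries one_pos hx
  refine monotoneOn_of_deriv_nonneg (convex_Ioi 0)
    (fun x hx => (hd x hx).continuousAt.continuousWithinAt) ?_ ?_
  · rw [interior_Ioi]
    exact fun x hx => (hd x hx).differentiableAt.differentiableWithinAt
  · rw [interior_Ioi]
    intro x hx
    rw [(hd x hx).deriv]
    have : (0 : ℝ) < x := hx
    positivity

/-- By scaling, the series at `t` is the mean of the `α = 1` series at `t^α X`, with `X` distributed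
as the random time at 1. One law serves both `t` and `t'`, and the `α = 1` series is increasing. -/
theorem monotoneOn_mlSeries {α r : ℝ} (hα : 0 < α) (hα1 : α ≤ 1)
    [IsProbabilityMeasure (randomTimeLaw α 1)] :
    MonotoneOn (mlSeries α (interarrivalCoeff r)) (Set.Ioi 0) := by
  intro t ht t' ht' htt'
  have ht : 0 < t := ht
  have ht' : 0 < t' := ht'
  set q := interarrivalCoeff r with hq
  have hgq : GeomBounded q := geomBounded_interarrivalCoeff r
  set s := t ^ α with hs
  set s' := t' ^ α with hs'
  have hs0 : 0 < s := by positivity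
  have hs0' : 0 < s' := by positivity
  have hss' : s ≤ s' := by simp only [hs, hs']; gcongr
  have key := integral_mlSeries_randomTimeLaw hα hα1 one_pos
    ((hgq.mul_pow s').sub (hgq.mul_pow s))
  have hsplit : ∀ x : ℝ, 0 < x → mlSeries 1 (fun j => q j * s' ^ j - q j * s ^ j) x =
      mlSeries 1 q (s' * x) - mlSeries 1 q (s * x) := fun x hx => by
    have h1 := (hgq.summable_mlSeries one_pos (mul_pos hs0' hx).le).of_norm
    have h2 := (hgq.summable_mlSeries one_pos (mul_pos hs0 hx).le).of_norm
    simp only [mlSeries]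
    rw [← h1.tsum_sub h2]
    refine tsum_congr fun j => ?_
    rw [one_mul, Real.rpow_natCast, Real.rpow_natCast, Real.rpow_natCast, mul_pow, mul_pow]
    ring
  have hnn : 0 ≤ ∫ x, mlSeries 1 (fun j => q j * s' ^ j - q j * s ^ j) x ∂randomTimeLaw α 1 := by
    refine integral_nonneg_of_ae ?_
    filter_upwards [randomTimeLaw_ae_pos (α := α) one_pos] with x hx
    rw [hsplit x hx, Pi.zero_apply, sub_nonneg]
    exact monotoneOn_mlSeries_one (mul_pos hs0 hx) (mul_pos hs0' hx) (by gcongr)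
  rw [key] at hnn
  have h1 := (hgq.summable_mlSeries hα ht.le).of_norm
  have h2 := (hgq.summable_mlSeries hα ht'.le).of_norm
  have e : mlSeries α (fun j => q j * s' ^ j - q j * s ^ j) 1 =
      mlSeries α q t' - mlSeries α q t := by
    simp only [mlSeries]
    rw [← h2.tsum_sub h1]
    refine tsum_congr fun j => ?_
    rw [Real.one_rpow, Real.rpow_mul ht.le, Real.rpow_mul ht'.le, Real.rpow_natCast,
      Real.rpow_natCast]
    ring
  rw [e] at hnn
  linarith

theorem interarrivalDensity_nonneg {α : ℝ} (r : ℝ) (hα : 0 < α) (hα1 : α ≤ 1)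
    [IsProbabilityMeasure (randomTimeLaw α 1)] (x : ℝ) : 0 ≤ interarrivalDensity α r x := by
  by_cases hx : 0 < x
  · rw [interarrivalDensity_eq_mlDerivSeries r hα hx]
    refine (((geomBounded_interarrivalCoeff r).hasDerivAt_mlSeries hα hx).hasDerivWithinAt
      (s := Set.Ioi 0)).nonneg_of_monotoneOn ?_ (monotoneOn_mlSeries hα hα1)
    exact accPt_principal_iff_nhdsWithin.2 (by
      have : (nhdsWithin x {x}ᶜ).NeBot := inferInstance
      rw [show Set.Ioi (0 : ℝ) \ {x} = {x}ᶜ ∩ Set.Ioi 0 by ext; simp [and_comm],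
        nhdsWithin_inter_of_mem' (mem_nhdsWithin_of_mem_nhds (Ioi_mem_nhds hx))]
      exact this)
  · rw [interarrivalDensity, if_neg hx]

theorem measurable_interarrivalDensity {α : ℝ} (r : ℝ) (hα : 0 < α) :
    Measurable (interarrivalDensity α r) := by
  have : interarrivalDensity α r =
      (Set.Ioi 0).indicator (deriv (mlSeries α (interarrivalCoeff r))) := by
    funext x
    by_cases hx : 0 < x
    · rw [Set.indicator_of_mem (Set.mem_Ioi.2 hx), interarrivalDensity_eq_mlDerivSeries r hα hx,
        ((geomBounded_interarrivalCoeff r).hasDerivAt_mlSeries hα hx).deriv]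
    · rw [Set.indicator_of_notMem (by simpa using hx), interarrivalDensity, if_neg hx]
  rw [this]
  exact (measurable_deriv _).indicator measurableSet_Ioi

theorem interarrivalLaw_ae_pos (α r : ℝ) : ∀ᵐ x ∂interarrivalLaw α r, 0 < x := by
  rw [interarrivalLaw, ae_iff]
  have : {a : ℝ | ¬0 < a} = Set.Iic 0 := by ext; simp
  rw [this, withDensity_apply _ measurableSet_Iic]
  refine (setLIntegral_congr_fun measurableSet_Iic fun x hx => ?_).trans lintegral_zero
  rw [interarrivalDensity, if_neg (not_lt.2 hx), ENNReal.ofReal_zero]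

/-- One renewal step for the distribution function of the arrival times. -/
theorem setIntegral_interarrivalLaw {α t : ℝ} (r : ℝ) (hα : 0 < α) (hα1 : α ≤ 1)
    [IsProbabilityMeasure (randomTimeLaw α 1)] {a : ℕ → ℝ} (ha : GeomBounded a) (ht : 0 ≤ t) :
    ∫ x in Set.Ioc 0 t, mlSeries α a (t - x) ∂interarrivalLaw α r =
      mlSeries α (cauchyProd a (interarrivalCoeff r)) t := by
  rcases ht.eq_or_lt with rfl | ht
  · rw [Set.Ioc_self, setIntegral_empty, mlSeries, eq_comm]
    refine (tsum_congr fun j => ?_).trans tsum_zero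
    rcases Nat.eq_zero_or_pos j with rfl | hj
    · simp [cauchyProd, interarrivalCoeff]
    · rw [Real.zero_rpow (by positivity), zero_div, mul_zero]
  · rw [← setIntegral_mlSeries_mul_mlDerivSeries ha (geomBounded_interarrivalCoeff r) rfl hα ht,
      interarrivalLaw, restrict_withDensity measurableSet_Ioc,
      integral_withDensity_eq_integral_toReal_smul
        (measurable_interarrivalDensity r hα).ennreal_ofReal
        (.of_forall fun _ => ENNReal.ofReal_lt_top)]
    refine setIntegral_congr_fun measurableSet_Ioc fun x hx => ?_
    rw [ENNReal.toReal_ofReal (interarrivalDensity_nonneg r hα hα1 x), smul_eq_mul, mul_comm,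
      interarrivalDensity_eq_mlDerivSeries r hα hx.1]

/-! ### Arrival times -/

/-- Used with `g y = t - y` for the renewal step and with `g = id` for the random time. -/
theorem measureReal_le_comp_of_indepFun {Ω : Type*} [MeasurableSpace Ω] {P : Measure Ω}
    [IsProbabilityMeasure P] {X Y : Ω → ℝ} (hX : AEMeasurable X P) (hY : AEMeasurable Y P)
    (hXY : IndepFun X Y P) {g : ℝ → ℝ} (hg : Measurable g) :
    P.real {ω | X ω ≤ g (Y ω)} = ∫ y, P.real {ω | X ω ≤ g y} ∂P.map Y := by
  have hs : MeasurableSet {p : ℝ × ℝ | p.1 ≤ g p.2} :=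
    measurableSet_le measurable_fst (hg.comp measurable_snd)
  have := Measure.isProbabilityMeasure_map hX
  have := Measure.isProbabilityMeasure_map hY
  have h1 : P {ω | X ω ≤ g (Y ω)} = ∫⁻ y, P {ω | X ω ≤ g y} ∂P.map Y := by
    have h2 := Measure.map_apply_of_aemeasurable (hX.prodMk hY) hs
    rw [(indepFun_iff_map_prod_eq_prod_map_map hX hY).1 hXY, Measure.prod_apply_symm hs] at h2
    refine h2.symm.trans (lintegral_congr fun y => ?_)
    exact Measure.map_apply_of_aemeasurable hX (measurable_prodMk_right hs)
  have hmeas : Measurable fun y => P {ω | X ω ≤ g y} := by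
    refine (congrArg Measurable (funext fun y => ?_)).mp
      (measurable_measure_prodMk_right (μ := P.map X) hs)
    exact Measure.map_apply_of_aemeasurable hX (measurable_prodMk_right hs)
  rw [measureReal_def, h1]
  exact (integral_toReal hmeas.aemeasurable (.of_forall fun _ => measure_lt_top _ _)).symm

theorem mlSeries_renewalCoeff_zero {α t : ℝ} (r : ℝ) : mlSeries α (renewalCoeff r 0) t = 1 := by
  rw [mlSeries, tsum_eq_single 0 fun j hj => by simp [renewalCoeff, hj]]
  simp [renewalCoeff]

section ArrivalTimes

variable {Ω : Type*} [MeasurableSpace Ω] {P : Measure Ω} {α r : ℝ} {W : ℕ → Ω → ℝ}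

theorem ae_arrival_nonneg (hW : ∀ i, HasLaw (W i) (interarrivalLaw α r) P) (n : ℕ) :
    ∀ᵐ ω ∂P, 0 ≤ ∑ i ∈ Finset.range n, W i ω := by
  have h : ∀ i, ∀ᵐ ω ∂P, 0 < W i ω := fun i =>
    ae_of_ae_map (hW i).aemeasurable (by rw [(hW i).map_eq]; exact interarrivalLaw_ae_pos α r)
  filter_upwards [ae_all_iff.2 h] with ω hω
  exact Finset.sum_nonneg fun i _ => (hω i).le

theorem aemeasurable_arrival (hW : ∀ i, HasLaw (W i) (interarrivalLaw α r) P) (n : ℕ) :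
    AEMeasurable (fun ω => ∑ i ∈ Finset.range n, W i ω) P :=
  Finset.aemeasurable_fun_sum _ fun i _ => (hW i).aemeasurable

/-- Condition on the last interarrival time `x`. The induction hypothesis covers `x ≤ t`; for `x >
t` the event is null because the earlier partial sum is a.s. nonnegative. -/
theorem measureReal_arrival_le [IsProbabilityMeasure P] (hα : 0 < α) (hα1 : α ≤ 1)
    [IsProbabilityMeasure (randomTimeLaw α 1)]
    (hW : ∀ i, HasLaw (W i) (interarrivalLaw α r) P) (hind : iIndepFun W P) (n : ℕ) {t : ℝ}
    (ht : 0 ≤ t) :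
    P.real {ω | ∑ i ∈ Finset.range n, W i ω ≤ t} = mlSeries α (renewalCoeff r n) t := by
  induction n generalizing t with
  | zero => simp [mlSeries_renewalCoeff_zero, ht]
  | succ n ih =>
    have hi : IndepFun (fun ω => ∑ i ∈ Finset.range n, W i ω) (W n) P := by
      have := hind.indepFun_finsetSum_of_notMem₀ (fun i => (hW i).aemeasurable)
        (Finset.notMem_range_self (n := n))
      convert this using 1
      funext ω
      rw [Finset.sum_apply]
    have e : {ω | ∑ i ∈ Finset.range (n + 1), W i ω ≤ t} =
        {ω | ∑ i ∈ Finset.range n, W i ω ≤ t - W n ω} := by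
      ext ω
      simp only [Set.mem_ofPred_eq, Finset.sum_range_succ]
      rw [le_sub_iff_add_le]
    rw [e, measureReal_le_comp_of_indepFun (g := fun y => t - y) (aemeasurable_arrival hW n)
      (hW n).aemeasurable hi (by fun_prop), (hW n).map_eq, renewalCoeff,
      ← setIntegral_interarrivalLaw r hα hα1 (geomBounded_renewalCoeff r n) ht,
      ← integral_indicator measurableSet_Ioc]
    refine integral_congr_ae ?_
    filter_upwards [interarrivalLaw_ae_pos α r] with x hx
    by_cases hxt : x ≤ t
    · rw [Set.indicator_of_mem (Set.mem_Ioc.2 ⟨hx, hxt⟩), ih (sub_nonneg.2 hxt)]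
    · rw [Set.indicator_of_notMem fun h => hxt h.2, measureReal_def,
        measure_eq_zero_iff_ae_notMem.2, ENNReal.toReal_zero]
      filter_upwards [ae_arrival_nonneg hW n] with ω hω hmem
      have : ∑ i ∈ Finset.range n, W i ω ≤ t - x := hmem
      linarith

/-- Independence is given for the counting process, not for the waiting times. But `{S_n ≤ x}` is
a.s. `{n ≤ N x}` for `x ≥ 0` and null for `x < 0`, and half-lines determine the law of `S_n`
restricted to an event of `T`. -/
theorem indepFun_arrival [IsProbabilityMeasure P]
    (hW : ∀ i, HasLaw (W i) (interarrivalLaw α r) P) {N : ℝ≥0 → Ω → ℕ}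
    (hN : ∀ᵐ ω ∂P, ∀ (t : ℝ≥0) (n : ℕ), n ≤ N t ω ↔ ∑ i ∈ Finset.range n, W i ω ≤ (t : ℝ))
    {T : Ω → ℝ≥0} (hT : AEMeasurable T P) (hind : IndepFun (fun ω (s : ℝ≥0) => N s ω) T P)
    (n : ℕ) : IndepFun (fun ω => ∑ i ∈ Finset.range n, W i ω) T P := by
  set S : Ω → ℝ := fun ω => ∑ i ∈ Finset.range n, W i ω with hS
  have hSm : AEMeasurable S P := aemeasurable_arrival hW n
  rw [indepFun_iff_measure_inter_preimage_eq_mul] at hind ⊢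
  intro A B hA hB
  have hBn : NullMeasurableSet (T ⁻¹' B) P := hT.nullMeasurable hB
  have key : (P.restrict (T ⁻¹' B)).map S = P (T ⁻¹' B) • P.map S := by
    refine Measure.ext_of_Iic _ _ fun x => ?_
    rw [Measure.map_apply_of_aemeasurable hSm.restrict measurableSet_Iic,
      Measure.restrict_apply₀' hBn, Measure.smul_apply, smul_eq_mul,
      Measure.map_apply_of_aemeasurable hSm measurableSet_Iic]
    rcases lt_or_ge x 0 with hx | hx
    · have h0 : P (S ⁻¹' Set.Iic x) = 0 := by
        rw [measure_eq_zero_iff_ae_notMem]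
        filter_upwards [ae_arrival_nonneg hW n] with ω hω hmem
        have : S ω ≤ x := hmem
        have : 0 ≤ S ω := hω
        linarith
      rw [h0, mul_zero]
      exact measure_mono_null Set.inter_subset_left h0
    · have he : S ⁻¹' Set.Iic x =ᵐ[P]
          (fun ω (s : ℝ≥0) => N s ω) ⁻¹' {f : ℝ≥0 → ℕ | n ≤ f ⟨x, hx⟩} := by
        filter_upwards [hN] with ω hω
        exact propext (hω ⟨x, hx⟩ n).symm
      rw [measure_congr (ae_eq_set_inter he (ae_eq_refl (T ⁻¹' B))), measure_congr he, mul_comm]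
      exact hind _ _ (measurableSet_le measurable_const (measurable_pi_apply _)) hB
  have h := congrArg (fun m => m A) key
  rw [Measure.map_apply_of_aemeasurable hSm.restrict hA,
      Measure.restrict_apply₀' hBn, Measure.smul_apply, smul_eq_mul,
      Measure.map_apply_of_aemeasurable hSm hA] at h
  rw [h, mul_comm]

end ArrivalTimes

/-! ### Equality in law of the counting variables -/

theorem aemeasurable_nat_of_nullMeasurableSet_le {Ω : Type*} [MeasurableSpace Ω] {P : Measure Ω}
    {X : Ω → ℕ} (h : ∀ n, NullMeasurableSet {ω | n ≤ X ω} P) : AEMeasurable X P := by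
  refine NullMeasurable.aemeasurable fun s _ => ?_
  have : X ⁻¹' s = ⋃ n ∈ s, {ω | n ≤ X ω} \ {ω | n + 1 ≤ X ω} := by
    ext ω
    simp only [Set.mem_preimage, Set.mem_iUnion, Set.mem_sdiff, Set.mem_ofPred_eq, exists_prop]
    refine ⟨fun hω => ⟨X ω, hω, le_rfl, by omega⟩, ?_⟩
    rintro ⟨n, hn, h1, h2⟩
    rwa [show X ω = n by omega]
  rw [this]
  exact .biUnion s.to_countable fun n _ => (h n).diff (h (n + 1))

theorem mainTheorem1 {Ω Ω' : Type*} [MeasurableSpace Ω] [MeasurableSpace Ω']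
    (P : Measure Ω) [IsProbabilityMeasure P] (P' : Measure Ω') [IsProbabilityMeasure P']
    (α r : ℝ) (hα : 0 < α) (hα1 : α ≤ 1) (hr : 0 < r)
    (Nα : ℝ≥0 → Ω' → ℕ) (hNα : IsMLRenewalProcess α r Nα P')
    (N : ℝ≥0 → Ω → ℕ) (hN : IsMLRenewalProcess 1 r N P)
    (T : ℝ≥0 → Ω → ℝ≥0)
    (hT : ∀ t : ℝ≥0, 0 < t → HasLaw (fun ω => (T t ω : ℝ)) (randomTimeLaw α t) P)
    (hind : ∀ t : ℝ≥0, 0 < t → IndepFun (fun ω (s : ℝ≥0) => N s ω) (T t) P) :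
    ∀ t : ℝ≥0, 0 < t → IdentDistrib (Nα t) (fun ω => N (T t ω) ω) P' P := by
  intro t ht
  obtain ⟨W', hW', hi', hc'⟩ := hNα
  obtain ⟨W, hW, hi, hc⟩ := hN
  -- A random variable with this law exists, so the law has mass 1. This is the only source of
  -- positivity for the folded solution and, through time 1, for the interarrival density.
  have hprob : ∀ s : ℝ≥0, 0 < s → IsProbabilityMeasure (randomTimeLaw α s) := fun s hs =>
    (hT s hs).isProbabilityMeasure_iff.1 inferInstance
  have hp1 : IsProbabilityMeasure (randomTimeLaw α 1) := by
    simpa using hprob 1 one_pos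
  have hpt := hprob t ht
  have hp11 : IsProbabilityMeasure (randomTimeLaw 1 1) := by
    rw [randomTimeLaw, if_pos rfl]; infer_instance
  have hTr : AEMeasurable (fun ω => (T t ω : ℝ)) P := (hT t ht).aemeasurable
  have hTm : AEMeasurable (T t) P := by simpa using hTr.real_toNNReal
  have e1 : ∀ n : ℕ, {ω | n ≤ Nα t ω} =ᵐ[P'] {ω | ∑ i ∈ Finset.range n, W' i ω ≤ (t : ℝ)} :=
    fun n => by
      filter_upwards [hc'] with ω hω
      exact propext (hω t n)
  have e2 : ∀ n : ℕ, {ω | n ≤ N (T t ω) ω} =ᵐ[P]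
      {ω | ∑ i ∈ Finset.range n, W i ω ≤ (T t ω : ℝ)} := fun n => by
    filter_upwards [hc] with ω hω
    exact propext (hω (T t ω) n)
  -- Measurability of the counting variables is not assumed; it is inherited from the arrival times.
  have m1 : AEMeasurable (Nα t) P' := aemeasurable_nat_of_nullMeasurableSet_le fun n =>
    (nullMeasurableSet_le (aemeasurable_arrival hW' n) aemeasurable_const).congr (e1 n).symm
  have m2 : AEMeasurable (fun ω => N (T t ω) ω) P := aemeasurable_nat_of_nullMeasurableSet_le
    fun n => (nullMeasurableSet_le (aemeasurable_arrival hW n) hTr).congr (e2 n).symm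
  refine ⟨m1, m2, ?_⟩
  have := Measure.isProbabilityMeasure_map m1
  refine Measure.ext_of_Ici _ _ fun n => ?_
  rw [Measure.map_apply_of_aemeasurable m1 measurableSet_Ici,
    Measure.map_apply_of_aemeasurable m2 measurableSet_Ici]
  change P' {ω | n ≤ Nα t ω} = P {ω | n ≤ N (T t ω) ω}
  rw [measure_congr (e1 n), measure_congr (e2 n)]
  refine (ENNReal.toReal_eq_toReal_iff' (measure_ne_top _ _) (measure_ne_top _ _)).1 ?_
  have h1 := measureReal_arrival_le hα hα1 hW' hi' n t.coe_nonneg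
  have h2 := measureReal_le_comp_of_indepFun (aemeasurable_arrival hW n) hTr
    ((indepFun_arrival hW hc hTm (hind t ht) n).comp measurable_id measurable_coe_nnreal_real)
    measurable_id
  rw [(hT t ht).map_eq] at h2
  have h3 : ∫ y, P.real {ω | ∑ i ∈ Finset.range n, W i ω ≤ y} ∂randomTimeLaw α t =
      ∫ y, mlSeries 1 (renewalCoeff r n) y ∂randomTimeLaw α t := by
    refine integral_congr_ae ?_
    filter_upwards [randomTimeLaw_ae_pos (α := α) (NNReal.coe_pos.2 ht)] with y hy
    exact measureReal_arrival_le one_pos le_rfl hW hi n hy.le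
  exact h1.trans ((integral_mlSeries_randomTimeLaw hα hα1 (NNReal.coe_pos.2 ht)
    (geomBounded_renewalCoeff r n)).symm.trans (h3.symm.trans h2.symm))
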